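/- Convention: all random elements take values in Polish spaces with their Borel $\sigma$-algebras, and conditional probabilities are regular. For random elements of a topological space, possibly defined on different probability spaces, $Z_n\overset{w}{\to}Z$ means $E\,g(Z_n)\to E\,g(Z)$ for every bounded continuous real $g$. Let $\mathscr D(\mathbb R)$ be the space of càdlàg functions $\mathbb R\to\mathbb R$ with the Skorokhod $J_1$ topology: $x_n\to x$ iff there are increasing bijections $\lambda_n$ of $\mathbb R$ with $\lambda_n\to\mathrm{id}$ and $x_n\circ\lambda_n\to x$ uniformly on bounded intervals. For each $n\in\mathbb N$ let $D_n$ (the data) and $W_n^*$ (auxiliary variates) be random elements defined on one probability space, let $\tau_n=\tau_n(D_n)$ and $\tau_n^*=\tau_n^*(D_n,W_n^*)$ be real random variables that are measurable functions of $D_n$ and of $(D_n,W_n^*)$ respectively, and let $X_n$ be a $D_n$-measurable random element. Let $p_n^*:=P(\tau_n^*\le\tau_n\mid D_n)$. The bootstrap based on $\tau_n$ and $\tau_n^*$ is called valid unconditionally if $P(p_n^*\le q)\to q$ for every $q\in(0,1)$. Let a real random variable $\tau$ and random elements $X,X'$ be defined on a single probability space, and suppose that $$(\tau_n|X_n,\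 \tau_n^*|D_n)\overset{w}{\to}_w(\tau|X,\ \tau|X'),\qquad(1)$$ meaning that for all bounded continuous $h,k:\mathbb R\to\mathbb R$ $$\big(E\{h(\tau_n)|X_n\},\,E\{k(\tau_n^*)|D_n\}\big)\overset{w}{\to}\big(E\{h(\tau)|X\},\,E\{k(\tau)|X'\}\big)\quad\text{in }\mathbb R^2 .$$ Suppose further that the random cdf's $F(u):=P(\tau\le u|X)$ and $F^*(u):=P(\tau\le u|X')$, $u\in\mathbb R$, are almost surely sample-path continuous. Then $$\big(P(\tau_n\le\cdot\,|X_n),\,P(\tau_n^*\le\cdot\,|D_n)\big)\overset{w}{\to}(F,F^*)\quad\text{in }\mathscr D(\mathbb R)\times\mathscr D(\mathbb R).$$ Moreover, the bootstrap based on $\tau_n$ and $\tau_n^*$ is valid unconditionally provided that one of the following extra conditions holds: (a) $X'=X$; (b) $X=(X',X'')$ for some random element $X''$, and there are $X_n$-measurable random elements $X_n'$ such that $X_n'\overset{w}{\to}X'$ jointly with (1), i.e. for all bounded continuous $h,k:\mathbb R\to\mathbb R$ $$\big(E\{h(\tau_n)|X_n\},\,E\{k(\tau_n^*)|D_n\},\,X_n'\big)\overset{w}{\to}\big(E\{h(\tau)|X\},\,E\{k(\tau)|X'\},\,X'\big).$$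 -/

import Mathlib

open MeasureTheory ProbabilityTheory Filter Topology Set
open scoped Uniformity BoundedContinuousFunction

/-- Càdlàg functions `ℝ → ℝ`: right-continuous with (finite) left limits at every point. -/
structure Cadlag where
  /-- The underlying function. -/
  toFun : ℝ → ℝ
  right_continuous : ∀ t, ContinuousWithinAt toFun (Ici t) t
  left_limit : ∀ t, ∃ l, Tendsto toFun (𝓝[<] t) (𝓝 l)

namespace Cadlag

instance : CoeFun Cadlag (fun _ => ℝ → ℝ) := ⟨Cadlag.toFun⟩

/-- `(x, y)` belongs to `entourage T ε` if some increasing bijection (time change) `lam` of `ℝ`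
satisfies `|lam t - t| < ε` and `|y (lam t) - x t| < ε` for all `t ∈ [-T, T]`. -/
def entourage (T ε : ℝ) : Set (Cadlag × Cadlag) :=
  {p | ∃ lam : ℝ ≃o ℝ, ∀ t : ℝ, |t| ≤ T → |lam t - t| < ε ∧ |p.2 (lam t) - p.1 t| < ε}

theorem entourage_mono {T T' ε ε' : ℝ} (hT : T' ≤ T) (hε : ε ≤ ε') :
    entourage T ε ⊆ entourage T' ε' := by
  rintro ⟨x, y⟩ ⟨lam, h⟩
  exact ⟨lam, fun t ht => ⟨(h t (ht.trans hT)).1.trans_le hε, (h t (ht.trans hT)).2.trans_le hε⟩⟩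

theorem entourage_symm {T ε : ℝ} (hT : 0 ≤ T) (hε : 0 < ε) :
    entourage (T + ε) ε ⊆ Prod.swap ⁻¹' entourage T ε := by
  rintro ⟨x, y⟩ ⟨lam, h⟩
  refine ⟨lam.symm, fun s hs => ?_⟩
  have hs' := abs_le.mp hs
  have h1 := abs_lt.mp (h (T + ε) (by rw [abs_of_nonneg (by linarith)])).1
  have h2 := abs_lt.mp (h (-(T + ε)) (by rw [abs_neg, abs_of_nonneg (by linarith)])).1
  have h3 : lam.symm s ≤ T + ε := by
    rw [OrderIso.symm_apply_le]; linarith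
  have h4 : -(T + ε) ≤ lam.symm s := by
    rw [OrderIso.le_symm_apply]; linarith
  have h5 := h (lam.symm s) (abs_le.mpr ⟨h4, h3⟩)
  simp only [OrderIso.apply_symm_apply] at h5
  exact ⟨by rw [abs_sub_comm]; exact h5.1, by rw [abs_sub_comm]; exact h5.2⟩

theorem entourage_comp {T ε : ℝ} (hε : 0 < ε) (x y z : Cadlag)
    (hxy : (x, y) ∈ entourage (T + ε) (ε / 2)) (hyz : (y, z) ∈ entourage (T + ε) (ε / 2)) :
    (x, z) ∈ entourage T ε := by
  obtain ⟨lam, h⟩ := hxy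
  obtain ⟨mu, k⟩ := hyz
  refine ⟨lam.trans mu, fun t ht => ?_⟩
  have h1 := h t (by linarith)
  have h2 := k (lam t) (by
    have := abs_sub_abs_le_abs_sub (lam t) t
    linarith [h1.1])
  simp only [OrderIso.trans_apply]
  have e1 := abs_sub_le (mu (lam t)) (lam t) t
  have e2 := abs_sub_le (z (mu (lam t))) (y (lam t)) (x t)
  exact ⟨by linarith [h1.1, h2.1], by linarith [h1.2, h2.2]⟩

/-- The sets `entourage T ε` with `T, ε > 0` are a filter basis on `Cadlag × Cadlag`. -/
def basis : FilterBasis (Cadlag × Cadlag) where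
  sets := {s | ∃ T ε : ℝ, 0 < T ∧ 0 < ε ∧ s = entourage T ε}
  nonempty := ⟨_, 1, 1, one_pos, one_pos, rfl⟩
  inter_sets := by
    rintro _ _ ⟨T, ε, hT, hε, rfl⟩ ⟨T', ε', hT', hε', rfl⟩
    exact ⟨_, ⟨max T T', min ε ε', lt_max_of_lt_left hT, lt_min hε hε', rfl⟩,
      subset_inter (entourage_mono (le_max_left _ _) (min_le_left _ _))
        (entourage_mono (le_max_right _ _) (min_le_right _ _))⟩

/-- The Skorokhod `J₁` topology on càdlàg functions `ℝ → ℝ`, as a uniform structure: `xₙ → x` iff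
there are increasing bijections `λₙ` of `ℝ` with `λₙ → id` and `xₙ ∘ λₙ → x`, both uniformly on
bounded intervals. -/
instance : UniformSpace Cadlag :=
  UniformSpace.ofCore <| UniformSpace.Core.mkOfBasis basis
    (by
      rintro _ ⟨T, ε, hT, hε, rfl⟩ x
      exact ⟨OrderIso.refl ℝ, fun t _ => by simpa using hε⟩)
    (by
      rintro _ ⟨T, ε, hT, hε, rfl⟩
      exact ⟨_, ⟨T + ε, ε, by linarith, hε, rfl⟩, entourage_symm hT.le hε⟩)
    (by
      rintro _ ⟨T, ε, hT, hε, rfl⟩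
      refine ⟨_, ⟨T + ε, ε / 2, by linarith, by linarith, rfl⟩, ?_⟩
      rintro ⟨x, z⟩ ⟨y, hxy, hyz⟩
      exact entourage_comp hε x y z hxy hyz)

theorem hasBasis_uniformity :
    (𝓤 Cadlag).HasBasis (fun p : ℝ × ℝ => 0 < p.1 ∧ 0 < p.2) (fun p => entourage p.1 p.2) := by
  refine ⟨fun s => ?_⟩
  refine (basis.hasBasis.mem_iff (t := s)).trans ⟨?_, ?_⟩
  · rintro ⟨_, ⟨T, ε, hT, hε, rfl⟩, h⟩
    exact ⟨(T, ε), ⟨hT, hε⟩, h⟩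
  · rintro ⟨⟨T, ε⟩, ⟨hT, hε⟩, h⟩
    exact ⟨_, ⟨T, ε, hT, hε, rfl⟩, h⟩

end Cadlag

section

variable {Ω : Type*} [MeasurableSpace Ω] {S : Type*} [MeasurableSpace S]

/-- The random cdf `u ↦ P(Z ≤ u | Y)`, computed from the regular conditional distribution of the
real random variable `Z` given the random element `Y`, as a map from `Ω` to càdlàg functions. -/
noncomputable def randomCdf (P : Measure Ω) [IsFiniteMeasure P] (Z : Ω → ℝ) (Y : Ω → S) (ω : Ω) :
    Cadlag where
  toFun u := cdf (condDistrib Z Y P (Y ω)) u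
  right_continuous := (cdf (condDistrib Z Y P (Y ω))).right_continuous
  left_limit t := ⟨_, (cdf (condDistrib Z Y P (Y ω))).mono.tendsto_nhdsLT t⟩

/-- The conditional expectation `E{Z | Y}` of a real random variable given a random element. -/
noncomputable def condExpGiven (P : Measure Ω) (Z : Ω → ℝ) (Y : Ω → S) : Ω → ℝ :=
  P[Z | MeasurableSpace.comap Y inferInstance]

/-- `Z` is `Y`-measurable, i.e. measurable for the σ-algebra generated by `Y`. -/
def MeasurableGiven {E : Type*} [MeasurableSpace E] (Z : Ω → E) (Y : Ω → S) : Prop :=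
  Measurable[MeasurableSpace.comap Y inferInstance] Z

end

section

variable {Ω : ℕ → Type*} [∀ n, MeasurableSpace (Ω n)] {Ωl : Type*} [MeasurableSpace Ωl]

/-- Weak convergence `Zₙ → Z` of random elements of a topological space with its Borel σ-algebra
(the random elements may live on different probability spaces). -/
def WeakConv {E : Type*} [TopologicalSpace E] (P : ∀ n, Measure (Ω n))
    [∀ n, IsProbabilityMeasure (P n)] (Pl : Measure Ωl) [IsProbabilityMeasure Pl]
    (Z : ∀ n, Ω n → E) (Zl : Ωl → E) : Prop :=
  letI : MeasurableSpace E := borel E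
  haveI : BorelSpace E := ⟨rfl⟩
  TendstoInDistribution Z atTop Zl P Pl

variable {A B : ℕ → Type*} [∀ n, MeasurableSpace (A n)] [∀ n, MeasurableSpace (B n)]
  {Al Bl : Type*} [MeasurableSpace Al] [MeasurableSpace Bl]
  {E₁ E₂ : Type*} [TopologicalSpace E₁] [TopologicalSpace E₂]

/-- Joint weak convergence in distribution `(Zₙ | Xₙ, Z'ₙ | Yₙ) → (Z | X, Z' | Y)`: for all bounded
continuous real `h, k`, the pair `(E{h(Zₙ) | Xₙ}, E{k(Z'ₙ) | Yₙ})` converges weakly in `ℝ × ℝ` to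
`(E{h(Z) | X}, E{k(Z') | Y})`. -/
def JointCondConv (P : ∀ n, Measure (Ω n)) [∀ n, IsProbabilityMeasure (P n)]
    (Pl : Measure Ωl) [IsProbabilityMeasure Pl]
    (Z : ∀ n, Ω n → E₁) (X : ∀ n, Ω n → A n) (Z' : ∀ n, Ω n → E₂) (Y : ∀ n, Ω n → B n)
    (Zl : Ωl → E₁) (Xl : Ωl → Al) (Zl' : Ωl → E₂) (Yl : Ωl → Bl) : Prop :=
  ∀ (h : E₁ →ᵇ ℝ) (k : E₂ →ᵇ ℝ),
    WeakConv P Pl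
      (fun n ω => (condExpGiven (P n) (fun ω' => h (Z n ω')) (X n) ω,
        condExpGiven (P n) (fun ω' => k (Z' n ω')) (Y n) ω))
      (fun ω => (condExpGiven Pl (fun ω' => h (Zl ω')) Xl ω,
        condExpGiven Pl (fun ω' => k (Zl' ω')) Yl ω))

/-- Weak convergence of random elements `Vₙ → V` jointly with the weak convergence in distribution
`(Zₙ | Xₙ, Z'ₙ | Yₙ) → (Z | X, Z' | Y)`: for all bounded continuous real `h, k`, the triple
`(E{h(Zₙ) | Xₙ}, E{k(Z'ₙ) | Yₙ}, Vₙ)` converges weakly to `(E{h(Z) | X}, E{k(Z') | Y}, V)`. -/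
def JointCondConvWith {S : Type*} [TopologicalSpace S]
    (P : ∀ n, Measure (Ω n)) [∀ n, IsProbabilityMeasure (P n)]
    (Pl : Measure Ωl) [IsProbabilityMeasure Pl]
    (Z : ∀ n, Ω n → E₁) (X : ∀ n, Ω n → A n) (Z' : ∀ n, Ω n → E₂) (Y : ∀ n, Ω n → B n)
    (V : ∀ n, Ω n → S)
    (Zl : Ωl → E₁) (Xl : Ωl → Al) (Zl' : Ωl → E₂) (Yl : Ωl → Bl) (Vl : Ωl → S) : Prop :=
  ∀ (h : E₁ →ᵇ ℝ) (k : E₂ →ᵇ ℝ),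
    WeakConv P Pl
      (fun n ω => (condExpGiven (P n) (fun ω' => h (Z n ω')) (X n) ω,
        condExpGiven (P n) (fun ω' => k (Z' n ω')) (Y n) ω, V n ω))
      (fun ω => (condExpGiven Pl (fun ω' => h (Zl ω')) Xl ω,
        condExpGiven Pl (fun ω' => k (Zl' ω')) Yl ω, Vl ω))

/-- The bootstrap `p`-value `P(τ* ≤ τ | D)`. -/
noncomputable def bootstrapPValue {Ω₀ S : Type*} [MeasurableSpace Ω₀] [MeasurableSpace S]
    (P : Measure Ω₀) (τ τstar : Ω₀ → ℝ) (D : Ω₀ → S) : Ω₀ → ℝ :=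
  condExpGiven P ({ω | τstar ω ≤ τ ω}.indicator (fun _ => 1)) D

/-- Unconditional validity of the bootstrap based on `τₙ` and `τ*ₙ`: the bootstrap `p`-value is
asymptotically uniformly distributed on `[0, 1]`. -/
def UnconditionallyValid (P : ∀ n, Measure (Ω n)) (τ τstar : ∀ n, Ω n → ℝ)
    (D : ∀ n, Ω n → A n) : Prop :=
  ∀ q ∈ Ioo (0 : ℝ) 1,
    Tendsto (fun n => (P n).real {ω | bootstrapPValue (P n) (τ n) (τstar n) (D n) ω ≤ q})
      atTop (𝓝 q)

end

/-! A law `μ` on the line is encoded by its integrals against countably many ramps with rational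
endpoints. Ramps sandwich the cdf, so convergence of these integrals to those of a law with
continuous cdf gives locally uniform convergence of cdf's (`tendsto_cdf_comap_rampIntegrals`), hence
J₁ convergence. Linear combinations of test functions are test functions, so (1) and Lévy continuity
yield joint convergence of all ramp integrals; continuous mapping then gives the first claim. Borel
measurability of random cdf's for J₁ comes from approximation by step functions (`tendsto_step`).

For validity, `p*ₙ` is a.s. the random cdf `F*ₙ` of `τ*ₙ` given `Dₙ`, evaluated at the
`Dₙ`-measurable `τₙ`. Its limit should be `F*(τ)`, which is uniform because `F*` is the continuous
conditional cdf of `τ` given `X'`. What is missing in (1) is the joint convergence of `F*ₙ` and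
`τₙ`. With `Kₙ = E{k(τ*ₙ)|Dₙ}` and `K` its limit, consider `E[a(Kₙ)h(τₙ)]`. If `Kₙ` is close in `L¹`
to something `Xₙ`-measurable, `h(τₙ)` may be replaced by `E{h(τₙ)|Xₙ}`; then (1) applies, and the
replacement is undone in the limit since `X'` is `X`-measurable
(`tendsto_integral_comp_condExpGiven_mul`). Under (a), `E{k(τₙ)|Xₙ}` is the approximation; under (b)
it is `g(X'ₙ)`, with `g` continuous and `g(X')` close to `E{k(τ)|X'}` in `L¹`. -/

/-! ### Weak convergence: portmanteau, Lévy continuity and continuous mapping. -/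

section WeakConvergence

variable {Ω : ℕ → Type*} [∀ n, MeasurableSpace (Ω n)] {Ωl : Type*} [MeasurableSpace Ωl]
  {P : ∀ n, Measure (Ω n)} [∀ n, IsProbabilityMeasure (P n)]
  {Pl : Measure Ωl} [IsProbabilityMeasure Pl]

theorem weakConv_iff_tendstoInDistribution {E : Type*} [TopologicalSpace E] [mE : MeasurableSpace E]
    [hE : BorelSpace E] {Z : ∀ n, Ω n → E} {Zl : Ωl → E} :
    WeakConv P Pl Z Zl ↔ TendstoInDistribution Z atTop Zl P Pl := by
  obtain ⟨rfl⟩ := hE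
  rfl

theorem MeasureTheory.TendstoInDistribution.tendsto_integral {E : Type*} [TopologicalSpace E]
    [MeasurableSpace E] [BorelSpace E] {Z : ∀ n, Ω n → E} {Zl : Ωl → E}
    (h : TendstoInDistribution Z atTop Zl P Pl) {g : E → ℝ} (hg : Continuous g)
    {C : ℝ} (hC : ∀ x, |g x| ≤ C) :
    Tendsto (fun n => ∫ ω, g (Z n ω) ∂P n) atTop (𝓝 (∫ ω, g (Zl ω) ∂Pl)) := by
  have h1 := ProbabilityMeasure.tendsto_iff_forall_integral_tendsto.mp h.tendsto
    (BoundedContinuousFunction.ofNormedAddCommGroup g hg C hC)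
  have h2 (n : ℕ) : ∫ x, g x ∂((P n).map (Z n)) = ∫ ω, g (Z n ω) ∂P n :=
    integral_map (h.forall_aemeasurable n) hg.measurable.aestronglyMeasurable
  have h3 : ∫ x, g x ∂(Pl.map Zl) = ∫ ω, g (Zl ω) ∂Pl :=
    integral_map h.aemeasurable_limit hg.measurable.aestronglyMeasurable
  rw [← h3]
  simp_rw [← h2]
  exact h1

theorem MeasureTheory.TendstoInDistribution.le_liminf_isOpen {E : Type*} [TopologicalSpace E]
    [MeasurableSpace E] [BorelSpace E] [HasOuterApproxClosed E] {Z : ∀ n, Ω n → E} {Zl : Ωl → E}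
    (h : TendstoInDistribution Z atTop Zl P Pl) {G : Set E} (hG : IsOpen G) :
    Pl (Zl ⁻¹' G) ≤ liminf (fun n => P n (Z n ⁻¹' G)) atTop := by
  have h1 := ProbabilityMeasure.le_liminf_measure_open_of_tendsto h.tendsto hG
  simp only [ProbabilityMeasure.coe_mk] at h1
  rw [Measure.map_apply_of_aemeasurable h.aemeasurable_limit hG.measurableSet] at h1
  refine h1.trans (liminf_le_liminf (Eventually.of_forall fun n => ?_))
  rw [Measure.map_apply_of_aemeasurable (h.forall_aemeasurable n) hG.measurableSet]

theorem tendstoInDistribution_of_le_liminf_isOpen {E : Type*} [TopologicalSpace E]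
    [MeasurableSpace E] [BorelSpace E] [HasOuterApproxClosed E] {Z : ∀ n, Ω n → E} {Zl : Ωl → E}
    (hZ : ∀ n, AEMeasurable (Z n) (P n)) (hZl : AEMeasurable Zl Pl)
    (h : ∀ G : Set E, IsOpen G → Pl (Zl ⁻¹' G) ≤ liminf (fun n => P n (Z n ⁻¹' G)) atTop) :
    TendstoInDistribution Z atTop Zl P Pl := by
  refine ⟨hZ, hZl, tendsto_of_forall_isOpen_le_liminf' fun G hG => ?_⟩
  simp only [ProbabilityMeasure.coe_mk]
  rw [Measure.map_apply_of_aemeasurable hZl hG.measurableSet]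
  refine (h G hG).trans (liminf_le_liminf (Eventually.of_forall fun n => ?_))
  rw [Measure.map_apply_of_aemeasurable (hZ n) hG.measurableSet]

/-- The phases `0` and `-π/2` produce the real and imaginary parts, so shifted cosines alone
determine the characteristic function. -/
theorem charFun_map_eq_integral_cos {Ω' : Type*} [MeasurableSpace Ω'] (Q : Measure Ω')
    [IsProbabilityMeasure Q] {J : Type*} [Fintype J] {Y : Ω' → EuclideanSpace ℝ J}
    (hY : AEMeasurable Y Q) (θ : EuclideanSpace ℝ J) :
    charFun (Q.map Y) θ = ((∫ ω, Real.cos (∑ j, θ j * Y ω j + 0) ∂Q : ℝ) : ℂ)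
      + ((∫ ω, Real.cos (∑ j, θ j * Y ω j + -(Real.pi / 2)) ∂Q : ℝ) : ℂ) * Complex.I := by
  have hin (ω : Ω') : inner ℝ (Y ω) θ = ∑ j, θ j * Y ω j := by
    simp [PiLp.inner_apply]
  have hY' : AEMeasurable (fun ω => ∑ j, θ j * Y ω j) Q := by
    simp_rw [← hin]; fun_prop
  rw [charFun_apply, integral_map hY (by fun_prop)]
  have hi (c : ℝ) : Integrable (fun ω => Real.cos (∑ j, θ j * Y ω j + c)) Q :=
    Integrable.of_bound (Real.measurable_cos.comp_aemeasurable
      (hY'.add_const c)).aestronglyMeasurable 1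
      (Eventually.of_forall fun ω => Real.abs_cos_le_one _)
  rw [← integral_complex_ofReal, ← integral_complex_ofReal, ← integral_mul_const,
    ← integral_add (hi 0).ofReal ((hi _).ofReal.mul_const _)]
  congr 1 with ω
  rw [hin, Complex.exp_mul_I, add_zero, ← sub_eq_add_neg, Real.cos_sub_pi_div_two,
    Complex.ofReal_cos, Complex.ofReal_sin]

/-- **Lévy continuity** in finite dimension, phrased with the functions `x ↦ cos (⟨θ, x⟩ + c)`. -/
theorem tendstoInDistribution_euclidean_of_tendsto_integral_cos {J : Type*} [Fintype J]
    {Z : ∀ n, Ω n → EuclideanSpace ℝ J} {Zl : Ωl → EuclideanSpace ℝ J}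
    (hZ : ∀ n, AEMeasurable (Z n) (P n)) (hZl : AEMeasurable Zl Pl)
    (h : ∀ (θ : J → ℝ) (c : ℝ), Tendsto (fun n => ∫ ω, Real.cos (∑ j, θ j * Z n ω j + c) ∂P n)
      atTop (𝓝 (∫ ω, Real.cos (∑ j, θ j * Zl ω j + c) ∂Pl))) :
    TendstoInDistribution Z atTop Zl P Pl := by
  refine ⟨hZ, hZl, ProbabilityMeasure.tendsto_of_tendsto_charFun fun θ => ?_⟩
  simp only [ProbabilityMeasure.coe_mk]
  rw [charFun_map_eq_integral_cos Pl hZl]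
  simp_rw [fun n => charFun_map_eq_integral_cos (P n) (hZ n)]
  exact ((Complex.continuous_ofReal.tendsto _).comp (h θ 0)).add
    (((Complex.continuous_ofReal.tendsto _).comp (h θ _)).mul_const _)

/-- Convergence in distribution in a countable product of lines, from the convergence of the
characteristic functions of the finite-dimensional marginals. -/
theorem tendstoInDistribution_pi_of_tendsto_integral_cos {ι : Type*} [Countable ι]
    {Z : ∀ n, Ω n → ι → ℝ} {Zl : Ωl → ι → ℝ}
    (hZ : ∀ n, AEMeasurable (Z n) (P n)) (hZl : AEMeasurable Zl Pl)
    (h : ∀ (J : Finset ι) (θ : ι → ℝ) (c : ℝ),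
      Tendsto (fun n => ∫ ω, Real.cos (∑ j ∈ J, θ j * Z n ω j + c) ∂P n)
        atTop (𝓝 (∫ ω, Real.cos (∑ j ∈ J, θ j * Zl ω j + c) ∂Pl))) :
    TendstoInDistribution Z atTop Zl P Pl := by
  refine tendstoInDistribution_of_le_liminf_isOpen hZ hZl fun G hG => ?_
  classical
  let r (J : Finset ι) (x : ι → ℝ) : EuclideanSpace ℝ J := WithLp.toLp 2 fun j : J => x j
  have hr (J : Finset ι) : Continuous (r J) := by fun_prop
  -- The largest open set in the `J`-coordinates whose cylinder lies in `G`. These cylinders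
  -- increase to `G`, so continuity from below reduces the portmanteau inequality to finitely many
  -- coordinates.
  let U (J : Finset ι) : Set (EuclideanSpace ℝ J) := ⋃₀ {V | IsOpen V ∧ r J ⁻¹' V ⊆ G}
  have hU (J : Finset ι) : IsOpen (U J) := isOpen_sUnion fun V hV => hV.1
  have hUG (J : Finset ι) : r J ⁻¹' U J ⊆ G := by
    rintro x ⟨V, hV, hx⟩
    exact hV.2 hx
  have hmono : Monotone fun J => r J ⁻¹' U J := by
    rintro J J' hJ x ⟨V, hV, hx⟩
    let p (y : EuclideanSpace ℝ J') : EuclideanSpace ℝ J :=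
      WithLp.toLp 2 fun j : J => y ⟨j, hJ j.2⟩
    have hp : Continuous p := by fun_prop
    exact ⟨p ⁻¹' V, ⟨hV.1.preimage hp, hV.2⟩, hx⟩
  have hcover : ⋃ J, r J ⁻¹' U J = G := by
    refine subset_antisymm (iUnion_subset hUG) fun x hx => ?_
    obtain ⟨I, u, hu, hI⟩ := isOpen_pi_iff.mp hG x hx
    refine mem_iUnion.mpr ⟨I, {y | ∀ i : I, y i ∈ u i}, ⟨?_, fun z hz => hI fun i hi => hz ⟨i, hi⟩⟩,
      fun i => (hu i i.2).2⟩
    rw [ofPred_forall]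
    exact isOpen_iInter_of_finite fun i => (hu i i.2).1.preimage (by fun_prop)
  have hsup : Pl (Zl ⁻¹' G) = ⨆ J, Pl (Zl ⁻¹' (r J ⁻¹' U J)) := by
    rw [← hcover, preimage_iUnion]
    exact Directed.measure_iUnion
      (directed_of_isDirected_le fun J J' hJ => preimage_mono (hmono hJ))
  rw [hsup]
  refine iSup_le fun J => ?_
  have hJ : TendstoInDistribution (fun n ω => r J (Z n ω)) atTop (fun ω => r J (Zl ω)) P Pl := by
    refine tendstoInDistribution_euclidean_of_tendsto_integral_cos
      (fun n => (hr J).measurable.comp_aemeasurable (hZ n))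
      ((hr J).measurable.comp_aemeasurable hZl) fun θ c => ?_
    have := h J (fun i => if hi : i ∈ J then θ ⟨i, hi⟩ else 0) c
    have e (x : ι → ℝ) : ∑ j ∈ J, (if hi : j ∈ J then θ ⟨j, hi⟩ else 0) * x j
        = ∑ j : J, θ j * r J x j := by
      rw [← Finset.sum_coe_sort]
      exact Finset.sum_congr rfl fun j _ => by simp [r]
    simpa only [e] using this
  exact (hJ.le_liminf_isOpen (hU J)).trans
    (liminf_le_liminf (Eventually.of_forall fun n => measure_mono (preimage_mono (hUG J))))

/-- **Continuous mapping theorem** for a map `G` which factors through an "observable" `e`, up to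
continuity at almost every limit point. -/
theorem tendstoInDistribution_of_tendsto_comap {M E F : Type*}
    [TopologicalSpace E] [MeasurableSpace E] [BorelSpace E] [HasOuterApproxClosed E]
    [TopologicalSpace F] [MeasurableSpace F] [BorelSpace F] [HasOuterApproxClosed F]
    (e : M → E) (G : M → F) {N : ∀ n, Ω n → M} {Nl : Ωl → M}
    (h : TendstoInDistribution (fun n ω => e (N n ω)) atTop (fun ω => e (Nl ω)) P Pl)
    (hG : ∀ᵐ ω ∂Pl, Tendsto G (comap e (𝓝 (e (Nl ω)))) (𝓝 (G (Nl ω))))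
    (hGN : ∀ n, AEMeasurable (fun ω => G (N n ω)) (P n))
    (hGNl : AEMeasurable (fun ω => G (Nl ω)) Pl) :
    TendstoInDistribution (fun n ω => G (N n ω)) atTop (fun ω => G (Nl ω)) P Pl := by
  refine tendstoInDistribution_of_le_liminf_isOpen hGN hGNl fun V hV => ?_
  -- The limit condition on `G` says that almost every limit point with `G`-value in `V` is observed
  -- inside this open set.
  let U : Set E := ⋃₀ {W | IsOpen W ∧ e ⁻¹' W ⊆ G ⁻¹' V}
  have hU : IsOpen U := isOpen_sUnion fun W hW => hW.1
  have hUV (m : M) (hm : e m ∈ U) : G m ∈ V := by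
    obtain ⟨W, hW, hx⟩ := hm
    exact hW.2 hx
  calc Pl ((fun ω => G (Nl ω)) ⁻¹' V) ≤ Pl ((fun ω => e (Nl ω)) ⁻¹' U) := by
        refine measure_mono_ae ?_
        filter_upwards [hG] with ω hω hmem
        obtain ⟨W, hW, hWV⟩ := mem_comap.mp (hω (hV.mem_nhds hmem))
        obtain ⟨W', hW', hW'o, hx⟩ := mem_nhds_iff.mp hW
        exact ⟨W', ⟨hW'o, (preimage_mono hW').trans hWV⟩, hx⟩
    _ ≤ liminf (fun n => P n ((fun ω => e (N n ω)) ⁻¹' U)) atTop := h.le_liminf_isOpen hU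
    _ ≤ _ := liminf_le_liminf (Eventually.of_forall fun n => measure_mono fun ω hω => hUV _ hω)

end WeakConvergence

/-! ### Ramp functions as a countable family determining continuous cdf's. -/

section Ramp

/-- The continuous function which is `1` up to `p.1`, `0` from `p.2` on, and affine in between
(of interest when `p.1 < p.2`). -/
noncomputable def ramp (p : ℚ × ℚ) : ℝ →ᵇ ℝ :=
  BoundedContinuousFunction.ofNormedAddCommGroup
    (fun t => max 0 (min 1 (((p.2 : ℝ) - t) / ((p.2 : ℝ) - p.1)))) (by fun_prop) 1 (fun t => by
      rw [Real.norm_eq_abs, abs_of_nonneg (le_max_left _ _)]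
      exact max_le zero_le_one (min_le_left _ _))

theorem ramp_apply (p : ℚ × ℚ) (t : ℝ) :
    ramp p t = max 0 (min 1 (((p.2 : ℝ) - t) / ((p.2 : ℝ) - p.1))) := rfl

theorem indicator_le_ramp {p : ℚ × ℚ} (hp : p.1 < p.2) (t : ℝ) :
    (Iic (p.1 : ℝ)).indicator 1 t ≤ ramp p t := by
  have hp' : (0 : ℝ) < (p.2 : ℝ) - p.1 := by exact_mod_cast sub_pos.mpr hp
  rw [ramp_apply]
  by_cases ht : t ≤ p.1
  · rw [indicator_of_mem (mem_Iic.mpr ht)]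
    refine le_max_of_le_right (le_min le_rfl ?_)
    rw [Pi.one_apply, one_le_div hp']
    linarith
  · rw [indicator_of_notMem (by simpa using ht)]
    exact le_max_left _ _

theorem ramp_le_indicator {p : ℚ × ℚ} (hp : p.1 < p.2) (t : ℝ) :
    ramp p t ≤ (Iic (p.2 : ℝ)).indicator 1 t := by
  have hp' : (0 : ℝ) < (p.2 : ℝ) - p.1 := by exact_mod_cast sub_pos.mpr hp
  rw [ramp_apply]
  by_cases ht : t ≤ p.2
  · rw [indicator_of_mem (mem_Iic.mpr ht)]
    exact max_le zero_le_one (min_le_left _ _)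
  · rw [indicator_of_notMem (by simpa using ht)]
    refine max_le le_rfl (min_le_of_right_le ?_)
    exact div_nonpos_of_nonpos_of_nonneg (by linarith) hp'.le

/-- The integrals of a probability measure against all ramp functions. -/
noncomputable def rampIntegrals (μ : ProbabilityMeasure ℝ) (p : ℚ × ℚ) : ℝ := ∫ t, ramp p t ∂μ

theorem cdf_le_rampIntegrals (μ : ProbabilityMeasure ℝ) {p : ℚ × ℚ} (hp : p.1 < p.2) :
    cdf μ p.1 ≤ rampIntegrals μ p := by
  rw [cdf_eq_real, ← integral_indicator_one measurableSet_Iic]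
  exact integral_mono ((integrable_const 1).indicator measurableSet_Iic)
    ((ramp p).integrable μ) (indicator_le_ramp hp)

theorem rampIntegrals_le_cdf (μ : ProbabilityMeasure ℝ) {p : ℚ × ℚ} (hp : p.1 < p.2) :
    rampIntegrals μ p ≤ cdf μ p.2 := by
  rw [cdf_eq_real, ← integral_indicator_one measurableSet_Iic]
  exact integral_mono ((ramp p).integrable μ)
    ((integrable_const 1).indicator measurableSet_Iic) (ramp_le_indicator hp)

/-- Convergence of the ramp integrals implies joint convergence of the cdf at a continuity point. -/
theorem tendsto_cdf_comap_rampIntegrals (μ₀ : ProbabilityMeasure ℝ) {t : ℝ}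
    (hc : ContinuousAt (cdf μ₀) t) :
    Tendsto (fun q : ProbabilityMeasure ℝ × ℝ => cdf q.1 q.2)
      (comap rampIntegrals (𝓝 (rampIntegrals μ₀)) ×ˢ 𝓝 t) (𝓝 (cdf μ₀ t)) := by
  have hcoord (p : ℚ × ℚ) : Tendsto (fun q : ProbabilityMeasure ℝ × ℝ => rampIntegrals q.1 p)
      (comap rampIntegrals (𝓝 (rampIntegrals μ₀)) ×ˢ 𝓝 t) (𝓝 (rampIntegrals μ₀ p)) :=
    ((continuous_apply p).tendsto (rampIntegrals μ₀)).comp (tendsto_comap.comp tendsto_fst)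
  refine tendsto_order.mpr ⟨fun u hu => ?_, fun u hu => ?_⟩
  -- For rationals `a < b < t` with `a` near `t`, the ramp on `(a, b)` bounds the cdf from below at
  -- every point beyond `b`; the upper bound is symmetric.
  · obtain ⟨l, r, ht, hlr⟩ := mem_nhds_iff_exists_Ioo_subset.mp (hc.eventually (lt_mem_nhds hu))
    obtain ⟨a, ha, hat⟩ := exists_rat_btwn ht.1
    obtain ⟨b, hb, hbt⟩ := exists_rat_btwn hat
    have hab : ((a, b) : ℚ × ℚ).1 < ((a, b) : ℚ × ℚ).2 := by exact_mod_cast hb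
    have hau : u < cdf μ₀ a := hlr ⟨ha, hat.trans ht.2⟩
    filter_upwards [(hcoord (a, b)).eventually
      (lt_mem_nhds (hau.trans_le (cdf_le_rampIntegrals μ₀ hab))),
      tendsto_snd.eventually (lt_mem_nhds hbt)] with q h1 h2
    exact (h1.trans_le (rampIntegrals_le_cdf q.1 hab)).trans_le (monotone_cdf q.1 h2.le)
  · obtain ⟨l, r, ht, hlr⟩ := mem_nhds_iff_exists_Ioo_subset.mp (hc.eventually (gt_mem_nhds hu))
    obtain ⟨b, htb, hb⟩ := exists_rat_btwn ht.2
    obtain ⟨a, hta, ha⟩ := exists_rat_btwn htb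
    have hab : ((a, b) : ℚ × ℚ).1 < ((a, b) : ℚ × ℚ).2 := by exact_mod_cast ha
    have hbu : cdf μ₀ b < u := hlr ⟨ht.1.trans htb, hb⟩
    filter_upwards [(hcoord (a, b)).eventually
      (gt_mem_nhds ((rampIntegrals_le_cdf μ₀ hab).trans_lt hbu)),
      tendsto_snd.eventually (gt_mem_nhds hta)] with q h1 h2
    exact (monotone_cdf q.1 h2.le).trans_lt ((cdf_le_rampIntegrals q.1 hab).trans_lt h1)

end Ramp

/-! ### The J₁ topology: Pólya's theorem, step approximation, Borel measurability. -/

namespace Cadlag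

/-- The cdf of a measure on the line as a càdlàg function. -/
noncomputable def ofCdf (μ : Measure ℝ) : Cadlag where
  toFun u := cdf μ u
  right_continuous := (cdf μ).right_continuous
  left_limit t := ⟨_, (cdf μ).mono.tendsto_nhdsLT t⟩

/-- **Pólya's theorem**: convergence of the ramp integrals to those of a measure with continuous
cdf implies convergence of the cdf in the Skorokhod topology. -/
theorem tendsto_ofCdf_comap_rampIntegrals (μ₀ : ProbabilityMeasure ℝ)
    (hc : Continuous (cdf μ₀)) :
    Tendsto (fun μ : ProbabilityMeasure ℝ => ofCdf μ)
      (comap rampIntegrals (𝓝 (rampIntegrals μ₀))) (𝓝 (ofCdf μ₀)) := by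
  have hloc : TendstoLocallyUniformly (fun (μ : ProbabilityMeasure ℝ) t => cdf μ t)
      (fun t => cdf μ₀ t) (comap rampIntegrals (𝓝 (rampIntegrals μ₀))) := by
    -- Locally uniform convergence amounts to convergence jointly in the measure and the point, near
    -- each `t`.
    refine tendstoLocallyUniformly_iff_forall_tendsto.mpr fun t => ?_
    rw [uniformity_eq_comap_nhds_zero, tendsto_comap_iff]
    have h1 := tendsto_cdf_comap_rampIntegrals μ₀ hc.continuousAt (t := t)
    have h2 : Tendsto (fun q : ProbabilityMeasure ℝ × ℝ => cdf μ₀ q.2)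
      (comap rampIntegrals (𝓝 (rampIntegrals μ₀)) ×ˢ 𝓝 t) (𝓝 (cdf μ₀ t)) :=
      hc.continuousAt.tendsto.comp tendsto_snd
    simpa [Function.comp_def] using h1.sub h2
  refine (nhds_basis_uniformity' hasBasis_uniformity).tendsto_right_iff.mpr ?_
  rintro ⟨T, ε⟩ ⟨-, hε⟩
  have hunif := (tendstoLocallyUniformlyOn_iff_tendstoUniformlyOn_of_compact
    (isCompact_Icc (a := -T) (b := T))).mp hloc.tendstoLocallyUniformlyOn
  filter_upwards [Metric.tendstoUniformlyOn_iff.mp hunif ε hε] with μ hμ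
  refine ⟨OrderIso.refl ℝ, fun t ht => ⟨by simpa using hε, ?_⟩⟩
  have := hμ t (abs_le.mp ht)
  rwa [dist_comm, Real.dist_eq] at this

/-- This makes the topology pseudo-metrizable, as needed for the portmanteau theorem and for
pointwise limits of measurable maps. -/
instance : (𝓤 Cadlag).IsCountablyGenerated := by
  have h : (𝓤 Cadlag).HasBasis (fun _ : ℕ => True)
      (fun n => entourage ((n : ℝ) + 1) (1 / ((n : ℝ) + 1))) := by
    refine hasBasis_uniformity.to_hasBasis (fun p hp => ?_) (fun n _ => ?_)
    · obtain ⟨n, hn⟩ := exists_nat_gt (max p.1 (1 / p.2))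
      have hn1 := (le_max_left _ _).trans_lt hn
      have hn2 := (le_max_right _ _).trans_lt hn
      refine ⟨n, trivial, entourage_mono (by linarith) ?_⟩
      rw [one_div_le (by positivity) hp.2]
      linarith
    · exact ⟨(n + 1, 1 / (n + 1)), ⟨by positivity, by positivity⟩, subset_rfl⟩
  exact h.isCountablyGenerated

/-- The step function with value `x k` on `[k / (m + 1), (k + 1) / (m + 1))`. -/
noncomputable def step (m : ℕ) (x : ℤ → ℝ) : Cadlag where
  toFun t := x ⌊t * (m + 1)⌋
  right_continuous t := by
    have h1 : Tendsto (fun s : ℝ => s * ((m : ℝ) + 1)) (𝓝[≥] t) (𝓝[≥] (t * (m + 1))) := by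
      refine tendsto_nhdsWithin_iff.mpr ⟨?_, ?_⟩
      · exact (Continuous.tendsto (by fun_prop) t).mono_left nhdsWithin_le_nhds
      · filter_upwards [self_mem_nhdsWithin] with s hs
        exact mul_le_mul_of_nonneg_right (mem_Ici.mp hs) (by positivity)
    exact (tendsto_pure_nhds x _).comp ((tendsto_floor_right_pure_floor _).comp h1)
  left_limit t := by
    have h1 : Tendsto (fun s : ℝ => s * ((m : ℝ) + 1)) (𝓝[<] t) (𝓝[<] (t * (m + 1))) := by
      refine tendsto_nhdsWithin_iff.mpr ⟨?_, ?_⟩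
      · exact (Continuous.tendsto (by fun_prop) t).mono_left nhdsWithin_le_nhds
      · filter_upwards [self_mem_nhdsWithin] with s hs
        exact mul_lt_mul_of_pos_right (mem_Iio.mp hs) (by positivity)
    exact ⟨_, (tendsto_pure_nhds x _).comp ((tendsto_floor_left_pure_ceil_sub_one _).comp h1)⟩

theorem continuous_step (m : ℕ) : Continuous (step m) := by
  refine continuous_iff_continuousAt.mpr fun x => ?_
  refine (nhds_basis_uniformity' hasBasis_uniformity).tendsto_right_iff.mpr ?_
  rintro ⟨T, ε⟩ ⟨-, hε⟩
  have h : ∀ᶠ y : ℤ → ℝ in 𝓝 x,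
      ∀ k ∈ Finset.Icc ⌊-T * ((m : ℝ) + 1)⌋ ⌊T * ((m : ℝ) + 1)⌋, |y k - x k| < ε := by
    refine (Filter.eventually_all_finset _).mpr fun k _ => ?_
    exact ((continuous_apply k).tendsto x).eventually (Metric.ball_mem_nhds (x k) hε)
  filter_upwards [h] with y hy
  refine ⟨OrderIso.refl ℝ, fun t ht => ⟨by simpa using hε, hy _ ?_⟩⟩
  rw [abs_le] at ht
  exact Finset.mem_Icc.mpr ⟨Int.floor_le_floor (mul_le_mul_of_nonneg_right ht.1 (by positivity)),
    Int.floor_le_floor (mul_le_mul_of_nonneg_right ht.2 (by positivity))⟩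

/-- A bounded monotone càdlàg function oscillates little on the cells of some finite partition. -/
theorem exists_finset_forall_abs_sub_le (x : Cadlag) (hx : Monotone x) (h0 : ∀ t, 0 ≤ x t)
    (h1 : ∀ t, x t ≤ 1) {ε : ℝ} (hε : 0 < ε) :
    ∃ F : Finset ℝ, ∀ s t, (∀ p ∈ F, s < p ↔ t < p) → |x s - x t| ≤ ε := by
  -- The first passage over level `iε`. The default value of `sInf` is harmless: `q i` is used only
  -- when `x s < iε ≤ x t`, so the set is nonempty and bounded below.
  let q (i : ℕ) : ℝ := sInf {t | i * ε ≤ x t}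
  obtain ⟨N, hN⟩ := exists_nat_gt (1 / ε)
  rw [div_lt_iff₀ hε] at hN
  refine ⟨(Finset.range (N + 1)).image q, ?_⟩
  have key : ∀ s t, s ≤ t → (∀ p ∈ (Finset.range (N + 1)).image q, s < p ↔ t < p) →
      |x s - x t| ≤ ε := by
    intro s t hst h
    rw [abs_sub_comm, abs_of_nonneg (sub_nonneg.mpr (hx hst))]
    by_contra! hlt
    -- The highest level not above `x t`. An increase of more than `ε` puts `x s` below it, so `q i`
    -- would separate `s` from `t`.
    obtain ⟨i, hi⟩ : ∃ i : ℕ, i = ⌊x t / ε⌋₊ := ⟨_, rfl⟩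
    have hi1 : i * ε ≤ x t := by
      rw [← le_div_iff₀ hε, hi]
      exact Nat.floor_le (div_nonneg (h0 t) hε.le)
    have hi2 : x t < (i + 1) * ε := by
      rw [← div_lt_iff₀ hε, hi]
      exact Nat.lt_floor_add_one _
    have hsi : x s < i * ε := by linarith
    have hiN : i < N + 1 := by
      have : (i : ℝ) < N := by
        by_contra! hle
        have := mul_le_mul_of_nonneg_right hle hε.le
        linarith [h1 t]
      exact_mod_cast this.trans (lt_add_one _)
    have hbdd : ∀ u ∈ {t | i * ε ≤ x t}, s < u := fun u hu =>
      lt_of_not_ge fun hus => absurd (hx hus) (not_le.mpr (hsi.trans_le hu))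
    have hqt : q i ≤ t := csInf_le ⟨s, fun u hu => (hbdd u hu).le⟩ hi1
    refine absurd ((h (q i) (Finset.mem_image_of_mem q (Finset.mem_range.mpr hiN))).mp ?_)
      (not_lt.mpr hqt)
    -- Strictness is where right-continuity enters: `x` stays below `iε` just to the right of `s`.
    refine lt_of_le_of_ne (le_csInf ⟨t, hi1⟩ fun u hu => (hbdd u hu).le) fun heq => ?_
    have hev : ∀ᶠ u in 𝓝[≥] s, x u < i * ε := (x.right_continuous s).eventually (gt_mem_nhds hsi)
    obtain ⟨u, hsu, hu⟩ := mem_nhdsGE_iff_exists_Ico_subset.mp hev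
    have : u ≤ q i := by
      refine le_csInf ⟨t, hi1⟩ fun v hv => ?_
      by_contra! hvu
      have hlt : x v < i * ε := hu ⟨(hbdd v hv).le, hvu⟩
      exact absurd hlt (not_lt.mpr hv)
    rw [← heq] at this
    exact absurd hsu (not_lt.mpr this)
  intro s t h
  rcases le_total s t with hst | hst
  · exact key s t hst h
  · rw [abs_sub_comm]
    exact key t s hst fun p hp => (h p hp).symm

/-- Small displacements of finitely many points extend to a time change close to the identity. -/
theorem exists_orderIso_eq_on_finset (F : Finset ℝ) {ε : ℝ} (hε : 0 < ε) :
    ∃ δ > 0, ∀ s : ℝ → ℝ, (∀ p ∈ F, |s p - p| ≤ δ) →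
      ∃ lam : ℝ ≃o ℝ, (∀ p ∈ F, lam p = s p) ∧ ∀ t, |lam t - t| < ε := by
  obtain ⟨r, hr, hsep⟩ : ∃ r > 0, ∀ p ∈ F, ∀ q ∈ F, p ≠ q → r ≤ |p - q| := by
    have : ∀ᶠ r in 𝓝[>] (0 : ℝ), ∀ z ∈ F ×ˢ F, z.1 ≠ z.2 → r ≤ |z.1 - z.2| := by
      refine (Filter.eventually_all_finset _).mpr fun z _ => ?_
      by_cases hz : z.1 = z.2
      · exact Eventually.of_forall fun r h => absurd hz h
      · filter_upwards [mem_nhdsWithin_of_mem_nhds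
          (gt_mem_nhds (abs_pos.mpr (sub_ne_zero.mpr hz)))] with r hr _ using hr.le
    obtain ⟨r, hr, hr0⟩ := (this.and self_mem_nhdsWithin).exists
    exact ⟨r, hr0, fun p hp q hq => hr (p, q) (Finset.mk_mem_product hp hq)⟩
  -- The total displacement is then at most `min ε r / 2`. The bound by `ε` keeps the time change
  -- near the identity; the bound by `r` keeps the perturbation `1/2`-Lipschitz, hence the sum
  -- strictly increasing. The `+ 1` covers empty `F`.
  refine ⟨min ε r / (2 * (F.card + 1)), by positivity, fun s hs => ?_⟩
  -- Since `r` separates the points of `F`, each tent vanishes at all the other points, so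
  -- displacements can be prescribed independently.
  let tent (p t : ℝ) : ℝ := max 0 (1 - |t - p| / r)
  have tent_self (p : ℝ) : tent p p = 1 := by simp [tent]
  have tent_ne {p q : ℝ} (hp : p ∈ F) (hq : q ∈ F) (hpq : q ≠ p) : tent p q = 0 := by
    refine max_eq_left (sub_nonpos.mpr ?_)
    rw [one_le_div hr]
    exact hsep q hq p hp hpq
  have tent_abs (p t : ℝ) : |tent p t| ≤ 1 := by
    rw [abs_of_nonneg (le_max_left _ _)]
    exact max_le zero_le_one (sub_le_self _ (by positivity))
  have tent_lip (p t u : ℝ) : |tent p t - tent p u| ≤ |t - u| / r := by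
    simp only [tent, max_comm (0 : ℝ)]
    refine (abs_max_sub_max_le_abs _ _ _).trans ?_
    rw [sub_sub_sub_cancel_left, ← sub_div, abs_div, abs_of_pos hr, abs_sub_comm t u]
    refine div_le_div_of_nonneg_right ?_ hr.le
    simpa using abs_abs_sub_abs_le (u - p) (t - p)
  have hsum : ∑ p ∈ F, |s p - p| ≤ min ε r / 2 := by
    calc ∑ p ∈ F, |s p - p| ≤ F.card • (min ε r / (2 * (F.card + 1))) :=
          Finset.sum_le_card_nsmul _ _ _ hs
      _ = min ε r / 2 * (F.card / (F.card + 1)) := by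
        rw [nsmul_eq_mul]; field_simp
      _ ≤ min ε r / 2 * 1 := by
        gcongr
        rw [div_le_one (by positivity)]
        linarith
      _ = _ := mul_one _
  have hmin : 0 < min ε r := lt_min hε hr
  let lam (t : ℝ) : ℝ := t + ∑ p ∈ F, (s p - p) * tent p t
  have hclose (t : ℝ) : |lam t - t| < ε := by
    calc |lam t - t| = |∑ p ∈ F, (s p - p) * tent p t| := by simp [lam]
      _ ≤ ∑ p ∈ F, |(s p - p) * tent p t| := Finset.abs_sum_le_sum_abs _ _
      _ ≤ ∑ p ∈ F, |s p - p| := Finset.sum_le_sum fun p _ => by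
        rw [abs_mul]
        exact mul_le_of_le_one_right (abs_nonneg _) (tent_abs p t)
      _ ≤ min ε r / 2 := hsum
      _ < ε := by linarith [min_le_left ε r]
  have hmono : StrictMono lam := by
    intro t u htu
    have : |∑ p ∈ F, (s p - p) * tent p t - ∑ p ∈ F, (s p - p) * tent p u| ≤ (u - t) / 2 := by
      calc _ = |∑ p ∈ F, (s p - p) * (tent p t - tent p u)| := by
            rw [← Finset.sum_sub_distrib]; simp only [mul_sub]
        _ ≤ ∑ p ∈ F, |(s p - p) * (tent p t - tent p u)| := Finset.abs_sum_le_sum_abs _ _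
        _ ≤ ∑ p ∈ F, |s p - p| * ((u - t) / r) := Finset.sum_le_sum fun p _ => by
            rw [abs_mul]
            gcongr
            refine (tent_lip p t u).trans_eq ?_
            rw [abs_sub_comm, abs_of_pos (sub_pos.mpr htu)]
        _ = (∑ p ∈ F, |s p - p|) * ((u - t) / r) := (Finset.sum_mul ..).symm
        _ ≤ (r / 2) * ((u - t) / r) := by
            have := sub_pos.mpr htu
            gcongr
            linarith [min_le_right ε r]
        _ = (u - t) / 2 := by field_simp
    simp only [lam]
    linarith [(abs_le.mp this).2]
  have hcont : Continuous lam := by fun_prop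
  have hsurj : Function.Surjective lam := by
    refine hcont.surjective ?_ ?_
    · exact tendsto_atTop_mono (fun t => by simp only [id]; linarith [(abs_lt.mp (hclose t)).1])
        (tendsto_atTop_add_const_right _ (-ε) tendsto_id)
    · exact tendsto_atBot_mono (fun t => by simp only [id]; linarith [(abs_lt.mp (hclose t)).2])
        (tendsto_atBot_add_const_right _ ε tendsto_id)
  refine ⟨hmono.orderIsoOfSurjective lam hsurj, fun p hp => ?_, hclose⟩
  change p + ∑ q ∈ F, (s q - q) * tent q p = s p
  rw [Finset.sum_eq_single_of_mem p hp fun q hq hqp => by rw [tent_ne hq hp hqp.symm, mul_zero],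
    tent_self]
  ring

/-- Discretizations of a bounded monotone càdlàg function converge to it in the `J₁` topology. -/
theorem tendsto_step (x : Cadlag) (hx : Monotone x) (h0 : ∀ t, 0 ≤ x t) (h1 : ∀ t, x t ≤ 1) :
    Tendsto (fun m : ℕ => step m fun k => x (k / (m + 1))) atTop (𝓝 x) := by
  refine (nhds_basis_uniformity' hasBasis_uniformity).tendsto_right_iff.mpr ?_
  rintro ⟨T, ε⟩ ⟨-, hε⟩
  obtain ⟨F, hF⟩ := exists_finset_forall_abs_sub_le x hx h0 h1 (half_pos hε)
  obtain ⟨δ, hδ, hlam⟩ := exists_orderIso_eq_on_finset F hε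
  have hlim := (tendsto_one_div_add_atTop_nhds_zero_nat (𝕜 := ℝ)).eventually (gt_mem_nhds hδ)
  filter_upwards [hlim] with m hm
  have hm0 : (0 : ℝ) < (m : ℝ) + 1 := by positivity
  -- Each partition point is moved up to the next grid point, so that the grid point sampled at `lam
  -- t` lies in the same cell as `t`.
  obtain ⟨lam, hlamF, hclose⟩ := hlam (fun p => ⌈p * ((m : ℝ) + 1)⌉ / ((m : ℝ) + 1)) fun p _ => by
    refine le_trans ?_ hm.le
    have e : (⌈p * ((m : ℝ) + 1)⌉ : ℝ) / ((m : ℝ) + 1) - p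
        = (⌈p * ((m : ℝ) + 1)⌉ - p * ((m : ℝ) + 1)) / ((m : ℝ) + 1) := by field_simp
    rw [e, abs_of_nonneg (div_nonneg (sub_nonneg.mpr (Int.le_ceil _)) hm0.le)]
    gcongr
    linarith [Int.ceil_lt_add_one (p * ((m : ℝ) + 1))]
  refine ⟨lam, fun t _ => ⟨hclose t, ?_⟩⟩
  refine (hF (⌊lam t * ((m : ℝ) + 1)⌋ / ((m : ℝ) + 1)) t fun p hp => ?_).trans_lt (half_lt_self hε)
  rw [div_lt_iff₀ hm0, ← Int.lt_ceil, Int.floor_lt, ← lt_div_iff₀ hm0, ← hlamF p hp,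
    lam.lt_iff_lt]

/-- A pair of random bounded monotone càdlàg functions is Borel measurable for the `J₁` topology as
soon as its evaluations are measurable. -/
theorem measurable_borel_prod {Ω : Type*} [MeasurableSpace Ω] {F G : Ω → Cadlag}
    [MeasurableSpace (Cadlag × Cadlag)] [BorelSpace (Cadlag × Cadlag)]
    (hF : ∀ ω, Monotone (F ω)) (hF0 : ∀ ω t, 0 ≤ F ω t) (hF1 : ∀ ω t, F ω t ≤ 1)
    (hFm : ∀ t, Measurable fun ω => F ω t)
    (hG : ∀ ω, Monotone (G ω)) (hG0 : ∀ ω t, 0 ≤ G ω t) (hG1 : ∀ ω t, G ω t ≤ 1)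
    (hGm : ∀ t, Measurable fun ω => G ω t) :
    Measurable fun ω => (F ω, G ω) := by
  refine measurable_of_tendsto_metrizable
    (f := fun (m : ℕ) ω => (step m fun k => F ω (k / (m + 1)), step m fun k => G ω (k / (m + 1))))
    (fun m => ?_) (tendsto_pi_nhds.mpr fun ω =>
      (tendsto_step (F ω) (hF ω) (hF0 ω) (hF1 ω)).prodMk_nhds
        (tendsto_step (G ω) (hG ω) (hG0 ω) (hG1 ω)))
  -- The pair is treated as one continuous image of countably many real coordinates, so no
  -- comparison between the Borel σ-algebra of the product and the product σ-algebra is needed on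
  -- the Skorokhod side.
  have hc : Continuous fun z : (ℤ → ℝ) × (ℤ → ℝ) => (step m z.1, step m z.2) :=
    ((continuous_step m).comp continuous_fst).prodMk ((continuous_step m).comp continuous_snd)
  exact hc.measurable.comp (g := fun z : (ℤ → ℝ) × (ℤ → ℝ) => (step m z.1, step m z.2))
    (f := fun ω => ((fun k : ℤ => F ω (k / (m + 1))), fun k : ℤ => G ω (k / (m + 1))))
    ((measurable_pi_lambda _ fun k => hFm _).prodMk (measurable_pi_lambda _ fun k => hGm _))

end Cadlag

/-! ### Conditional laws, the probability integral transform and the `p`-value. -/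

section ConditionalLaw

variable {Ω : Type*} [MeasurableSpace Ω] {S : Type*} [MeasurableSpace S]

/-- The regular conditional law of a real random variable `Z` given a random element `Y`. -/
noncomputable def condLaw (P : Measure Ω) [IsFiniteMeasure P] (Z : Ω → ℝ) (Y : Ω → S) (ω : Ω) :
    ProbabilityMeasure ℝ :=
  ⟨condDistrib Z Y P (Y ω), inferInstance⟩

variable {P : Measure Ω} {Z : Ω → ℝ} {Y : Ω → S}

theorem measurable_integral_condLaw [IsFiniteMeasure P] (hY : Measurable Y) (h : ℝ →ᵇ ℝ) :
    Measurable fun ω => ∫ t, h t ∂(condLaw P Z Y ω : Measure ℝ) := by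
  have h1 : StronglyMeasurable fun p : S × ℝ => h p.2 :=
    (h.continuous.measurable.comp measurable_snd).stronglyMeasurable
  exact (h1.integral_condDistrib (Y := Z) (X := Y) (μ := P)).measurable.comp hY

theorem condExpGiven_ae_eq_integral_condLaw [IsProbabilityMeasure P] (hZ : Measurable Z)
    (hY : Measurable Y) (h : ℝ →ᵇ ℝ) :
    condExpGiven P (fun ω => h (Z ω)) Y
      =ᵐ[P] fun ω => ∫ t, h t ∂(condLaw P Z Y ω : Measure ℝ) :=
  condExp_ae_eq_integral_condDistrib hY hZ.aemeasurable h.continuous.measurable.stronglyMeasurable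
    (Integrable.of_bound (h.continuous.measurable.comp hZ).aestronglyMeasurable ‖h‖
      (Eventually.of_forall fun _ => h.norm_coe_le_norm _))

theorem ae_abs_condExpGiven_le [IsProbabilityMeasure P] (hZ : Measurable Z)
    (hY : Measurable Y) (h : ℝ →ᵇ ℝ) :
    ∀ᵐ ω ∂P, |condExpGiven P (fun ω => h (Z ω)) Y ω| ≤ ‖h‖ := by
  filter_upwards [condExpGiven_ae_eq_integral_condLaw hZ hY h] with ω hω
  rw [hω]
  exact (norm_integral_le_of_norm_le_const
    (Eventually.of_forall fun t => h.norm_coe_le_norm t)).trans_eq (by simp)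

theorem measurableGiven_condExpGiven (P : Measure Ω) (Z : Ω → ℝ) (Y : Ω → S) :
    MeasurableGiven (condExpGiven P Z Y) Y :=
  stronglyMeasurable_condExp.measurable

/-- Pulling out a bounded factor which is measurable for the conditioning element. -/
theorem integral_mul_condExpGiven [IsProbabilityMeasure P] (hZ : Measurable Z) (hY : Measurable Y)
    (h : ℝ →ᵇ ℝ) {U : Ω → ℝ} (hU : MeasurableGiven U Y) {C : ℝ} (hC : ∀ ω, |U ω| ≤ C) :
    ∫ ω, U ω * condExpGiven P (fun ω => h (Z ω)) Y ω ∂P = ∫ ω, U ω * h (Z ω) ∂P := by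
  have hint : Integrable (fun ω => h (Z ω)) P :=
    Integrable.of_bound (h.continuous.measurable.comp hZ).aestronglyMeasurable ‖h‖
      (Eventually.of_forall fun _ => h.norm_coe_le_norm _)
  have h1 := condExp_stronglyMeasurable_mul_of_bound hY.comap_le
    (Measurable.stronglyMeasurable hU) hint C (Eventually.of_forall hC)
  rw [← integral_condExp hY.comap_le (f := fun ω => U ω * h (Z ω))]
  exact (integral_congr_ae h1).symm

/-- Joint measurability permits a random cdf to be evaluated at a random point; it follows from
measurability of the kernel mass of the sections of `{u ≤ t}`. -/
theorem measurable_cdf_kernel (κ : Kernel S ℝ) [IsMarkovKernel κ] :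
    Measurable fun p : S × ℝ => cdf (κ p.1) p.2 := by
  have hset : MeasurableSet {q : (S × ℝ) × ℝ | q.2 ≤ q.1.2} :=
    measurableSet_le measurable_snd measurable_fst.snd
  have h := Kernel.measurable_kernel_prodMk_left (κ := κ.comap (Prod.fst : S × ℝ → S)
    measurable_fst) hset
  simp_rw [cdf_eq_real]
  exact h.ennreal_toReal

theorem measurable_randomCdf_apply [IsProbabilityMeasure P] (hY : Measurable Y) (t : ℝ) :
    Measurable fun ω => randomCdf P Z Y ω t :=
  (measurable_cdf_kernel (condDistrib Z Y P)).comp (hY.prodMk measurable_const)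

theorem measurable_randomCdf_prodMk [IsProbabilityMeasure P] {S' : Type*} [MeasurableSpace S']
    [MeasurableSpace (Cadlag × Cadlag)] [BorelSpace (Cadlag × Cadlag)] {Z' : Ω → ℝ} {Y' : Ω → S'}
    (hY : Measurable Y) (hY' : Measurable Y') :
    Measurable fun ω => (randomCdf P Z Y ω, randomCdf P Z' Y' ω) := by
  exact Cadlag.measurable_borel_prod (fun _ => monotone_cdf _) (fun _ => cdf_nonneg _)
    (fun _ => cdf_le_one _) (measurable_randomCdf_apply hY) (fun _ => monotone_cdf _) (fun _ => cdf_nonneg _)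
    (fun _ => cdf_le_one _) (measurable_randomCdf_apply hY')

/-- **Probability integral transform** for a continuous cdf. -/
theorem measure_cdf_le (μ : Measure ℝ) [IsProbabilityMeasure μ] (hc : Continuous (cdf μ)) {q : ℝ}
    (hq : q ∈ Ioo (0 : ℝ) 1) : μ {u | cdf μ u ≤ q} = ENNReal.ofReal q := by
  obtain ⟨l, hl⟩ := ((tendsto_cdf_atBot μ).eventually (gt_mem_nhds hq.1)).exists
  obtain ⟨r, hr⟩ := ((tendsto_cdf_atTop μ).eventually (lt_mem_nhds hq.2)).exists
  have hbdd : BddAbove {u | cdf μ u ≤ q} :=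
    ⟨r, fun u hu => le_of_not_gt fun hru => absurd (monotone_cdf μ hru.le)
      (not_le.mpr (lt_of_le_of_lt hu hr))⟩
  have hmem : sSup {u | cdf μ u ≤ q} ∈ {u | cdf μ u ≤ q} :=
    (isClosed_le hc continuous_const).csSup_mem ⟨l, hl.le⟩ hbdd
  obtain ⟨t, ht⟩ : ∃ t, t = sSup {u | cdf μ u ≤ q} := ⟨_, rfl⟩
  rw [← ht] at hmem
  have hset : {u | cdf μ u ≤ q} = Iic t := by
    ext u
    refine ⟨fun hu => ht ▸ le_csSup hbdd hu, fun hu => (monotone_cdf μ hu).trans hmem⟩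
  have hval : cdf μ t = q := by
    refine le_antisymm hmem (le_of_not_gt fun hlt => ?_)
    have hev : ∀ᶠ u in 𝓝[>] t, cdf μ u < q :=
      (hc.continuousAt.eventually (gt_mem_nhds hlt)).filter_mono nhdsWithin_le_nhds
    obtain ⟨u, hu, htu⟩ := (hev.and self_mem_nhdsWithin).exists
    have hut : u ∈ {u | cdf μ u ≤ q} := hu.le
    rw [hset] at hut
    exact absurd hut (not_le.mpr htu)
  rw [hset, ← ofReal_cdf, hval]

/-- If the random cdf of `Z` given `Y` is continuous, its value at `Z` is uniformly distributed. -/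
theorem measure_cdf_condLaw_le [IsProbabilityMeasure P] (hZ : Measurable Z) (hY : Measurable Y)
    (hc : ∀ᵐ ω ∂P, Continuous (cdf (condLaw P Z Y ω))) {q : ℝ} (hq : q ∈ Ioo (0 : ℝ) 1) :
    P {ω | cdf (condLaw P Z Y ω) (Z ω) ≤ q} = ENNReal.ofReal q := by
  have hs : MeasurableSet {p : S × ℝ | cdf (condDistrib Z Y P p.1) p.2 ≤ q} :=
    measurableSet_le (measurable_cdf_kernel _) measurable_const
  calc P {ω | cdf (condLaw P Z Y ω) (Z ω) ≤ q}
      = P.map (fun ω => (Y ω, Z ω)) {p : S × ℝ | cdf (condDistrib Z Y P p.1) p.2 ≤ q} :=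
        (Measure.map_apply (hY.prodMk hZ) hs).symm
    -- The joint law is disintegrated along `Y`; for almost every fixed value of `Y` the inner mass
    -- is `q`.
    _ = ∫⁻ ω, condDistrib Z Y P (Y ω) {u | cdf (condDistrib Z Y P (Y ω)) u ≤ q} ∂P := by
        rw [← compProd_map_condDistrib hZ.aemeasurable, Measure.compProd_apply hs,
          lintegral_map (Kernel.measurable_kernel_prodMk_left hs) hY]
        rfl
    _ = ∫⁻ _, ENNReal.ofReal q ∂P := by
        refine lintegral_congr_ae ?_
        filter_upwards [hc] with ω hω using measure_cdf_le _ hω hq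
    _ = ENNReal.ofReal q := by simp

/-- The bootstrap `p`-value is the random cdf of the bootstrap statistic, evaluated at the original
statistic. -/
theorem bootstrapPValue_ae_eq [IsProbabilityMeasure P] {τ τstar : Ω → ℝ} (hτstar : Measurable τstar)
    (hY : Measurable Y) {T : S → ℝ} (hT : Measurable T) (hτ : ∀ ω, τ ω = T (Y ω)) :
    bootstrapPValue P τ τstar Y =ᵐ[P] fun ω => cdf (condLaw P τstar Y ω) (τ ω) := by
  have hs : MeasurableSet {p : S × ℝ | p.2 ≤ T p.1} :=
    measurableSet_le measurable_snd (hT.comp measurable_fst)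
  -- Given `Y`, the threshold `T (Y)` is frozen, so the event becomes a half-line under the
  -- conditional law.
  have h := condExp_prod_ae_eq_integral_condDistrib (μ := P) hY hτstar.aemeasurable
    (f := {p : S × ℝ | p.2 ≤ T p.1}.indicator fun _ => (1 : ℝ))
    (stronglyMeasurable_const.indicator hs)
    (Integrable.of_bound ((stronglyMeasurable_const.indicator hs).measurable.comp
      (hY.prodMk hτstar)).aestronglyMeasurable 1 (Eventually.of_forall fun ω =>
        (norm_indicator_le_norm_self _ _).trans (by simp)))
  have he : (fun ω => {p : S × ℝ | p.2 ≤ T p.1}.indicator (fun _ => (1 : ℝ)) (Y ω, τstar ω))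
      = {ω | τstar ω ≤ τ ω}.indicator fun _ => 1 := by
    ext ω
    simp [indicator_apply, hτ]
  rw [he] at h
  refine h.trans (Eventually.of_forall fun ω => ?_)
  change _ = cdf (condDistrib τstar Y P (Y ω)) (τ ω)
  rw [cdf_eq_real, ← integral_indicator_one measurableSet_Iic, hτ]
  rfl

end ConditionalLaw

/-! ### Weak convergence of the random cdf's. -/

section Limits

variable {Ω : ℕ → Type*} [∀ n, MeasurableSpace (Ω n)] {Ωl : Type*} [MeasurableSpace Ωl]
  {P : ∀ n, Measure (Ω n)} [∀ n, IsProbabilityMeasure (P n)]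
  {Pl : Measure Ωl} [IsProbabilityMeasure Pl]
  {A B : ℕ → Type*} [∀ n, MeasurableSpace (A n)] [∀ n, MeasurableSpace (B n)]
  {Al Bl : Type*} [MeasurableSpace Al] [MeasurableSpace Bl]

/-- The Cramér–Wold reduction: it lets convergence for single test functions control finite
families. -/
theorem sum_mul_integral_eq {ι : Type*} (J : Finset ι) (θ : ι → ℝ) (f : ι → ℝ →ᵇ ℝ)
    (μ : ProbabilityMeasure ℝ) :
    ∑ j ∈ J, θ j * ∫ t, f j t ∂(μ : Measure ℝ) = ∫ t, (∑ j ∈ J, θ j • f j) t ∂(μ : Measure ℝ) := by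
  simp_rw [BoundedContinuousFunction.coe_sum, Finset.sum_apply,
    BoundedContinuousFunction.coe_smul, smul_eq_mul]
  rw [integral_finsetSum _ fun j _ => ((f j).integrable _).const_mul _]
  simp_rw [integral_const_mul]

theorem measurable_rampIntegrals_condLaw {Ω S : Type*} [MeasurableSpace Ω] [MeasurableSpace S]
    {P : Measure Ω} [IsFiniteMeasure P] {Z : Ω → ℝ} {Y : Ω → S} (hY : Measurable Y) (p : ℚ × ℚ) :
    Measurable fun ω => rampIntegrals (condLaw P Z Y ω) p :=
  measurable_integral_condLaw hY (ramp p)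

/-- The random cdf's converge weakly in the Skorokhod topology if their limits are continuous. -/
theorem weakConv_randomCdf {Z Z' : ∀ n, Ω n → ℝ} {X : ∀ n, Ω n → A n} {Y : ∀ n, Ω n → B n}
    {Zl Zl' : Ωl → ℝ} {Xl : Ωl → Al} {Yl : Ωl → Bl}
    (hZ : ∀ n, Measurable (Z n)) (hZ' : ∀ n, Measurable (Z' n)) (hX : ∀ n, Measurable (X n))
    (hY : ∀ n, Measurable (Y n)) (hZl : Measurable Zl) (hZl' : Measurable Zl')
    (hXl : Measurable Xl) (hYl : Measurable Yl)
    (hconv : JointCondConv P Pl Z X Z' Y Zl Xl Zl' Yl)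
    (hcX : ∀ᵐ ω ∂Pl, Continuous (randomCdf Pl Zl Xl ω))
    (hcY : ∀ᵐ ω ∂Pl, Continuous (randomCdf Pl Zl' Yl ω)) :
    WeakConv P Pl
      (fun n ω => (randomCdf (P n) (Z n) (X n) ω, randomCdf (P n) (Z' n) (Y n) ω))
      (fun ω => (randomCdf Pl Zl Xl ω, randomCdf Pl Zl' Yl ω)) := by
  let : MeasurableSpace (Cadlag × Cadlag) := borel _
  have : BorelSpace (Cadlag × Cadlag) := ⟨rfl⟩
  refine weakConv_iff_tendstoInDistribution.mpr ?_
  let e (m : ProbabilityMeasure ℝ × ProbabilityMeasure ℝ) : (ℚ × ℚ) ⊕ (ℚ × ℚ) → ℝ :=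
    Sum.elim (rampIntegrals m.1) (rampIntegrals m.2)
  refine tendstoInDistribution_of_tendsto_comap e
    (fun m : ProbabilityMeasure ℝ × ProbabilityMeasure ℝ => (Cadlag.ofCdf m.1, Cadlag.ofCdf m.2))
    (N := fun n ω => (condLaw (P n) (Z n) (X n) ω, condLaw (P n) (Z' n) (Y n) ω))
    (Nl := fun ω => (condLaw Pl Zl Xl ω, condLaw Pl Zl' Yl ω)) ?_ ?_
    (fun n => (measurable_randomCdf_prodMk (hX n) (hY n)).aemeasurable)
    (measurable_randomCdf_prodMk hXl hYl).aemeasurable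
  · refine tendstoInDistribution_pi_of_tendsto_integral_cos
      (fun n => (measurable_pi_lambda _ fun j => ?_).aemeasurable)
      (measurable_pi_lambda _ fun j => ?_).aemeasurable fun J θ c => ?_
    · cases j with
      | inl p => exact measurable_rampIntegrals_condLaw (hX n) p
      | inr p => exact measurable_rampIntegrals_condLaw (hY n) p
    · cases j with
      | inl p => exact measurable_rampIntegrals_condLaw hXl p
      | inr p => exact measurable_rampIntegrals_condLaw hYl p
    -- `h` and `k` collect the ramps belonging to the first and to the second conditional law.
    let h : ℝ →ᵇ ℝ := ∑ j ∈ J, θ j • Sum.elim ramp (fun _ => 0) j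
    let k : ℝ →ᵇ ℝ := ∑ j ∈ J, θ j • Sum.elim (fun _ => 0) ramp j
    have he (μ ν : ProbabilityMeasure ℝ) : ∑ j ∈ J, θ j * e (μ, ν) j
        = ∫ t, h t ∂(μ : Measure ℝ) + ∫ t, k t ∂(ν : Measure ℝ) := by
      rw [← sum_mul_integral_eq, ← sum_mul_integral_eq, ← Finset.sum_add_distrib]
      refine Finset.sum_congr rfl fun j _ => ?_
      cases j <;> simp [e, rampIntegrals]
    simp_rw [he]
    have hlim := (weakConv_iff_tendstoInDistribution.mp (hconv h k)).tendsto_integral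
      (g := fun x => Real.cos (x.1 + x.2 + c)) (by fun_prop) (fun x => Real.abs_cos_le_one _)
    refine (hlim.congr fun n => integral_congr_ae ?_).trans_eq (congrArg 𝓝 (integral_congr_ae ?_))
    · filter_upwards [condExpGiven_ae_eq_integral_condLaw (hZ n) (hX n) h,
        condExpGiven_ae_eq_integral_condLaw (hZ' n) (hY n) k] with ω h1 h2
      rw [h1, h2]
    · filter_upwards [condExpGiven_ae_eq_integral_condLaw hZl hXl h,
        condExpGiven_ae_eq_integral_condLaw hZl' hYl k] with ω h1 h2
      rw [h1, h2]
  · filter_upwards [hcX, hcY] with ω h1 h2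
    refine Tendsto.prodMk_nhds
      ((Cadlag.tendsto_ofCdf_comap_rampIntegrals (condLaw Pl Zl Xl ω) h1).comp
        (tendsto_comap_iff.mpr ?_))
      ((Cadlag.tendsto_ofCdf_comap_rampIntegrals (condLaw Pl Zl' Yl ω) h2).comp
        (tendsto_comap_iff.mpr ?_))
    · have hp : Continuous fun (y : (ℚ × ℚ) ⊕ (ℚ × ℚ) → ℝ) p => y (Sum.inl p) := by fun_prop
      exact (hp.tendsto _).comp tendsto_comap
    · have hp : Continuous fun (y : (ℚ × ℚ) ⊕ (ℚ × ℚ) → ℝ) p => y (Sum.inr p) := by fun_prop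
      exact (hp.tendsto _).comp tendsto_comap

end Limits

/-! ### Unconditional validity through asymptotic measurability. -/

section Validity

variable {Ω : ℕ → Type*} [∀ n, MeasurableSpace (Ω n)] {Ωl : Type*} [MeasurableSpace Ωl]
  {P : ∀ n, Measure (Ω n)} [∀ n, IsProbabilityMeasure (P n)]
  {Pl : Measure Ωl} [IsProbabilityMeasure Pl]
  {A B : ℕ → Type*} [∀ n, MeasurableSpace (A n)] [∀ n, MeasurableSpace (B n)]
  {Al Bl : Type*} [MeasurableSpace Al] [MeasurableSpace Bl]

/-- The conditional laws of `Z'ₙ` given `Yₙ` are asymptotically measurable for `Xₙ`: their integrals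
are close in mean to `Xₙ`-measurable random variables. -/
def AsymptoticallyMeasurableGiven (P : ∀ n, Measure (Ω n)) (Z' : ∀ n, Ω n → ℝ) (Y : ∀ n, Ω n → B n)
    (X : ∀ n, Ω n → A n) : Prop :=
  ∀ (k : ℝ →ᵇ ℝ) (ε : ℝ), 0 < ε → ∃ R : ∀ n, Ω n → ℝ,
    (∀ n, MeasurableGiven (R n) (X n)) ∧ (∀ n, Integrable (R n) (P n)) ∧
    ∀ᶠ n in atTop, ∫ ω, |condExpGiven (P n) (fun ω => k (Z' n ω)) (Y n) ω - R n ω| ∂P n ≤ ε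

/-- The residual `h(Z) - E{h(Z)|X}` is orthogonal to the `X`-measurable `a(R)`, so `a(K)` may be
replaced by `a(K) - a(R)`. The Lipschitz bound controls this factor, and the residual is at most
`2‖h‖`. -/
theorem abs_integral_mul_sub_integral_mul_condExpGiven_le {Ω A : Type*} [MeasurableSpace Ω]
    [MeasurableSpace A] {P : Measure Ω} [IsProbabilityMeasure P] {Z K R : Ω → ℝ} {X : Ω → A}
    (hZ : Measurable Z) (hX : Measurable X) (h : ℝ →ᵇ ℝ) {a : ℝ → ℝ} (ha : LipschitzWith 1 a)
    (ha1 : ∀ x, |a x| ≤ 1) (hK : Integrable K P) (hR : Integrable R P)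
    (hRX : MeasurableGiven R X) :
    |∫ ω, a (K ω) * h (Z ω) ∂P - ∫ ω, a (K ω) * condExpGiven P (fun ω => h (Z ω)) X ω ∂P|
      ≤ (2 * ‖h‖) * ∫ ω, |K ω - R ω| ∂P := by
  have ham : ∀ {V : Ω → ℝ}, Integrable V P → AEStronglyMeasurable (fun ω => a (V ω)) P :=
    fun hV => ha.continuous.comp_aestronglyMeasurable hV.aestronglyMeasurable
  have hhi : Integrable (fun ω => h (Z ω)) P :=
    Integrable.of_bound (h.continuous.measurable.comp hZ).aestronglyMeasurable ‖h‖
      (Eventually.of_forall fun _ => h.norm_coe_le_norm _)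
  have hHi : Integrable (condExpGiven P (fun ω => h (Z ω)) X) P := integrable_condExp
  have hint {V U : Ω → ℝ} (hV : Integrable V P) (hU : Integrable U P) :
      Integrable (fun ω => a (V ω) * U ω) P :=
    hU.bdd_mul (c := 1) (ham hV) (Eventually.of_forall fun ω => ha1 _)
  have hpull := integral_mul_condExpGiven (P := P) hZ hX h (U := fun ω => a (R ω))
    (ha.continuous.measurable.comp hRX) (fun ω => ha1 _)
  have e : ∫ ω, a (K ω) * h (Z ω) ∂P - ∫ ω, a (K ω) * condExpGiven P (fun ω => h (Z ω)) X ω ∂P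
      = ∫ ω, (a (K ω) - a (R ω)) * (h (Z ω) - condExpGiven P (fun ω => h (Z ω)) X ω) ∂P := by
    have e2 : ∀ ω, (a (K ω) - a (R ω)) * (h (Z ω) - condExpGiven P (fun ω => h (Z ω)) X ω)
        = (a (K ω) * h (Z ω) - a (K ω) * condExpGiven P (fun ω => h (Z ω)) X ω)
          - (a (R ω) * h (Z ω) - a (R ω) * condExpGiven P (fun ω => h (Z ω)) X ω) :=
      fun ω => by ring
    simp_rw [e2]
    have hi {V : Ω → ℝ} (hV : Integrable V P) : Integrable (fun ω => a (V ω) * h (Z ω)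
        - a (V ω) * condExpGiven P (fun ω => h (Z ω)) X ω) P := (hint hV hhi).sub (hint hV hHi)
    rw [integral_sub (hi hK) (hi hR), integral_sub (hint hK hhi) (hint hK hHi),
      integral_sub (hint hR hhi) (hint hR hHi), hpull, sub_self, sub_zero]
  rw [e, ← integral_const_mul]
  have hbound : Integrable (fun ω => 2 * ‖h‖ * |K ω - R ω|) P := (hK.sub hR).abs.const_mul _
  refine norm_integral_le_of_norm_le (G := ℝ) hbound ?_
  filter_upwards [ae_abs_condExpGiven_le hZ hX h] with ω hω
  rw [norm_mul, mul_comm]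
  refine mul_le_mul ?_ ?_ (norm_nonneg _) (by positivity)
  · rw [two_mul]
    exact (norm_sub_le _ _).trans (add_le_add (h.norm_coe_le_norm _) hω)
  · simpa [Real.dist_eq] using ha.dist_le_mul (K ω) (R ω)

/-- The decisive step: `h(Zₙ)` is exchanged for its conditional expectation at vanishing cost, and
exchanged back exactly in the limit because `Yl` is `Xl`-measurable. -/
theorem tendsto_integral_comp_condExpGiven_mul {Z Z' : ∀ n, Ω n → ℝ} {X : ∀ n, Ω n → A n}
    {Y : ∀ n, Ω n → B n} {Zl Zl' : Ωl → ℝ} {Xl : Ωl → Al} {Yl : Ωl → Bl}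
    (hZ : ∀ n, Measurable (Z n)) (hX : ∀ n, Measurable (X n))
    (hZl : Measurable Zl) (hXl : Measurable Xl)
    (hconv : JointCondConv P Pl Z X Z' Y Zl Xl Zl' Yl)
    (hasymp : AsymptoticallyMeasurableGiven P Z' Y X) (hYX : MeasurableGiven Yl Xl)
    (h k : ℝ →ᵇ ℝ) {a : ℝ → ℝ} (ha : LipschitzWith 1 a) (ha1 : ∀ x, |a x| ≤ 1) :
    Tendsto (fun n => ∫ ω, a (condExpGiven (P n) (fun ω => k (Z' n ω)) (Y n) ω) * h (Z n ω) ∂P n)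
      atTop
      (𝓝 (∫ ω, a (condExpGiven Pl (fun ω => k (Zl' ω)) Yl ω) * h (Zl ω) ∂Pl)) := by
  -- Truncation makes the test function bounded; it is a.s. inactive on the conditional
  -- expectations.
  let clamp (x : ℝ) : ℝ := max (-‖h‖) (min ‖h‖ x)
  have hclamp (x : ℝ) : |clamp x| ≤ ‖h‖ :=
    abs_le.mpr ⟨le_max_left _ _, max_le (by linarith [norm_nonneg h]) (min_le_left _ _)⟩
  have hclamp_eq {x : ℝ} (hx : |x| ≤ ‖h‖) : clamp x = x := by
    simp only [clamp, min_eq_right (abs_le.mp hx).2, max_eq_right (abs_le.mp hx).1]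
  have hac := ha.continuous
  have hlim := (weakConv_iff_tendstoInDistribution.mp (hconv h k)).tendsto_integral
    (g := fun x => a x.2 * clamp x.1) (by fun_prop) (C := 1 * ‖h‖) (fun x => by
      rw [abs_mul]
      exact mul_le_mul (ha1 _) (hclamp _) (abs_nonneg _) zero_le_one)
  have hlim' : Tendsto (fun n => ∫ ω, a (condExpGiven (P n) (fun ω => k (Z' n ω)) (Y n) ω)
        * condExpGiven (P n) (fun ω => h (Z n ω)) (X n) ω ∂P n) atTop
      (𝓝 (∫ ω, a (condExpGiven Pl (fun ω => k (Zl' ω)) Yl ω) * h (Zl ω) ∂Pl)) := by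
    refine (hlim.congr fun n => integral_congr_ae ?_).trans_eq (congrArg 𝓝 ?_)
    · filter_upwards [ae_abs_condExpGiven_le (hZ n) (hX n) h] with ω hω
      rw [hclamp_eq hω]
    · have hU : MeasurableGiven (fun ω => a (condExpGiven Pl (fun ω => k (Zl' ω)) Yl ω)) Xl :=
        hac.measurable.comp ((measurableGiven_condExpGiven Pl _ Yl).mono hYX.comap_le le_rfl)
      rw [← integral_mul_condExpGiven hZl hXl h hU (fun ω => ha1 _)]
      refine integral_congr_ae ?_
      filter_upwards [ae_abs_condExpGiven_le hZl hXl h] with ω hω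
      rw [hclamp_eq hω]
  have hdiff : Tendsto (fun n =>
      ∫ ω, a (condExpGiven (P n) (fun ω => k (Z' n ω)) (Y n) ω) * h (Z n ω) ∂P n
      - ∫ ω, a (condExpGiven (P n) (fun ω => k (Z' n ω)) (Y n) ω)
        * condExpGiven (P n) (fun ω => h (Z n ω)) (X n) ω ∂P n) atTop (𝓝 0) := by
    refine Metric.tendsto_atTop'.mpr fun ε hε => ?_
    obtain ⟨R, hRX, hRi, hR⟩ := hasymp k (ε / (2 * (2 * ‖h‖ + 1))) (by positivity)
    obtain ⟨N, hN⟩ := eventually_atTop.mp hR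
    refine ⟨N, fun n hn => ?_⟩
    rw [dist_zero_right, Real.norm_eq_abs]
    refine (abs_integral_mul_sub_integral_mul_condExpGiven_le (hZ n) (hX n) h ha ha1
      integrable_condExp (hRi n) (hRX n)).trans_lt ?_
    calc (2 * ‖h‖) * ∫ ω, |condExpGiven (P n) (fun ω => k (Z' n ω)) (Y n) ω - R n ω| ∂P n
        ≤ (2 * ‖h‖ + 1) * (ε / (2 * (2 * ‖h‖ + 1))) := by
          refine mul_le_mul (by linarith) (hN n hn.le) (integral_nonneg fun _ => abs_nonneg _)
            (by positivity)
      _ = ε / 2 := by field_simp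
      _ < ε := half_lt_self hε
  simpa using hdiff.add hlim'

/-- The addition formula splits the joint cosine into products of a 1-Lipschitz function of the
conditional expectation and a bounded continuous function of `Z`, as
`tendsto_integral_comp_condExpGiven_mul` requires. -/
theorem integral_cos_integral_condLaw_add {Ω B : Type*} [MeasurableSpace Ω] [MeasurableSpace B]
    {P : Measure Ω} [IsProbabilityMeasure P] {Z Z' : Ω → ℝ} {Y : Ω → B} (hZ : Measurable Z)
    (hZ' : Measurable Z') (hY : Measurable Y) (k : ℝ →ᵇ ℝ) (φ c : ℝ) :
    ∫ ω, Real.cos (∫ t, k t ∂(condLaw P Z' Y ω : Measure ℝ) + φ * Z ω + c) ∂P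
      = ∫ ω, Real.cos (condExpGiven P (fun ω => k (Z' ω)) Y ω) * Real.cos (φ * Z ω + c) ∂P
        - ∫ ω, Real.sin (condExpGiven P (fun ω => k (Z' ω)) Y ω) * Real.sin (φ * Z ω + c) ∂P := by
  have hK : Measurable (condExpGiven P (fun ω => k (Z' ω)) Y) :=
    (measurableGiven_condExpGiven P _ Y).mono hY.comap_le le_rfl
  have hbound {u v : ℝ} (hu : |u| ≤ 1) (hv : |v| ≤ 1) : ‖u * v‖ ≤ 1 := by
    rw [norm_mul]
    exact mul_le_one₀ hu (norm_nonneg _) hv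
  rw [← integral_sub
    (Integrable.of_bound (by fun_prop) 1 (Eventually.of_forall fun ω =>
      hbound (Real.abs_cos_le_one _) (Real.abs_cos_le_one _)))
    (Integrable.of_bound (by fun_prop) 1 (Eventually.of_forall fun ω =>
      hbound (Real.abs_sin_le_one _) (Real.abs_sin_le_one _)))]
  refine integral_congr_ae ?_
  filter_upwards [condExpGiven_ae_eq_integral_condLaw hZ' hY k] with ω hω
  rw [hω, add_assoc, Real.cos_add]

/-- If the conditional laws of `Z'ₙ` are asymptotically `Xₙ`-measurable, the random cdf of `Z'ₙ`
evaluated at `Zₙ` converges in distribution. -/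
theorem tendstoInDistribution_cdf_condLaw_apply {Z Z' : ∀ n, Ω n → ℝ} {X : ∀ n, Ω n → A n}
    {Y : ∀ n, Ω n → B n} {Zl Zl' : Ωl → ℝ} {Xl : Ωl → Al} {Yl : Ωl → Bl}
    (hZ : ∀ n, Measurable (Z n)) (hZ' : ∀ n, Measurable (Z' n)) (hX : ∀ n, Measurable (X n))
    (hY : ∀ n, Measurable (Y n)) (hZl : Measurable Zl) (hZl' : Measurable Zl')
    (hXl : Measurable Xl) (hYl : Measurable Yl)
    (hconv : JointCondConv P Pl Z X Z' Y Zl Xl Zl' Yl)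
    (hasymp : AsymptoticallyMeasurableGiven P Z' Y X) (hYX : MeasurableGiven Yl Xl)
    (hc : ∀ᵐ ω ∂Pl, Continuous (cdf (condLaw Pl Zl' Yl ω))) :
    TendstoInDistribution (fun n ω => cdf (condLaw (P n) (Z' n) (Y n) ω) (Z n ω)) atTop
      (fun ω => cdf (condLaw Pl Zl' Yl ω) (Zl ω)) P Pl := by
  let e (m : ProbabilityMeasure ℝ × ℝ) : (ℚ × ℚ) ⊕ Unit → ℝ :=
    Sum.elim (rampIntegrals m.1) (fun _ => m.2)
  refine tendstoInDistribution_of_tendsto_comap e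
    (fun m : ProbabilityMeasure ℝ × ℝ => cdf m.1 m.2)
    (N := fun n ω => (condLaw (P n) (Z' n) (Y n) ω, Z n ω))
    (Nl := fun ω => (condLaw Pl Zl' Yl ω, Zl ω)) ?_ ?_
    (fun n => ((measurable_cdf_kernel (condDistrib (Z' n) (Y n) (P n))).comp
      ((hY n).prodMk (hZ n))).aemeasurable)
    ((measurable_cdf_kernel (condDistrib Zl' Yl Pl)).comp (hYl.prodMk hZl)).aemeasurable
  · refine tendstoInDistribution_pi_of_tendsto_integral_cos
      (fun n => (measurable_pi_lambda _ fun j => ?_).aemeasurable)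
      (measurable_pi_lambda _ fun j => ?_).aemeasurable fun J θ c => ?_
    · cases j with
      | inl p => exact measurable_rampIntegrals_condLaw (hY n) p
      | inr p => exact hZ n
    · cases j with
      | inl p => exact measurable_rampIntegrals_condLaw hYl p
      | inr p => exact hZl
    let k : ℝ →ᵇ ℝ := ∑ j ∈ J, θ j • Sum.elim ramp (fun _ => 0) j
    let φ : ℝ := ∑ j ∈ J, θ j * Sum.elim (fun _ => 0) (fun _ => 1) j
    let hcos : ℝ →ᵇ ℝ := BoundedContinuousFunction.ofNormedAddCommGroup
      (fun t => Real.cos (φ * t + c)) (by fun_prop) 1 (fun t => Real.abs_cos_le_one _)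
    let hsin : ℝ →ᵇ ℝ := BoundedContinuousFunction.ofNormedAddCommGroup
      (fun t => Real.sin (φ * t + c)) (by fun_prop) 1 (fun t => Real.abs_sin_le_one _)
    have he (μ : ProbabilityMeasure ℝ) (t : ℝ) : ∑ j ∈ J, θ j * e (μ, t) j
        = ∫ t, k t ∂(μ : Measure ℝ) + φ * t := by
      rw [← sum_mul_integral_eq, Finset.sum_mul, ← Finset.sum_add_distrib]
      refine Finset.sum_congr rfl fun j _ => ?_
      cases j <;> simp [e, rampIntegrals]
    have hlim := (tendsto_integral_comp_condExpGiven_mul hZ hX hZl hXl hconv hasymp hYX hcos k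
      (a := Real.cos) Real.lipschitzWith_cos Real.abs_cos_le_one).sub
      (tendsto_integral_comp_condExpGiven_mul hZ hX hZl hXl hconv hasymp hYX hsin k
      (a := Real.sin) Real.lipschitzWith_sin Real.abs_sin_le_one)
    simp_rw [he]
    refine (hlim.congr fun n => ?_).trans_eq (congrArg 𝓝 ?_)
    · exact (integral_cos_integral_condLaw_add (hZ n) (hZ' n) (hY n) k φ c).symm
    · exact (integral_cos_integral_condLaw_add hZl hZl' hYl k φ c).symm
  · filter_upwards [hc] with ω hω
    refine (tendsto_cdf_comap_rampIntegrals (condLaw Pl Zl' Yl ω) hω.continuousAt).comp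
      (tendsto_prod_iff'.mpr ⟨tendsto_comap_iff.mpr ?_, ?_⟩)
    · have hp : Continuous fun (y : (ℚ × ℚ) ⊕ Unit → ℝ) p => y (Sum.inl p) := by fun_prop
      exact (hp.tendsto _).comp tendsto_comap
    · exact ((continuous_apply (Sum.inr ())).tendsto (e (condLaw Pl Zl' Yl ω, Zl ω))).comp
        tendsto_comap

/-- An atom at `q` would fit inside `(r, q]`, of mass `q - r`, for every `r < q`. Its absence makes
`Iic q` a continuity set of the limit law. -/
theorem measure_preimage_singleton_eq_zero_of_uniform {Ω : Type*} [MeasurableSpace Ω]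
    {P : Measure Ω} [IsProbabilityMeasure P] {V : Ω → ℝ} (hV : Measurable V)
    (hunif : ∀ q ∈ Ioo (0 : ℝ) 1, P {ω | V ω ≤ q} = ENNReal.ofReal q) {q : ℝ}
    (hq : q ∈ Ioo (0 : ℝ) 1) : P (V ⁻¹' {q}) = 0 := by
  rw [← measureReal_eq_zero_iff]
  refine le_antisymm (le_of_not_gt fun hpos => ?_) measureReal_nonneg
  have hle {r : ℝ} (hr : 0 < r) (hrq : r < q) : P.real (V ⁻¹' {q}) + r ≤ q := by
    have hreal {s : ℝ} (hs : s ∈ Ioo (0 : ℝ) 1) : P.real {ω | V ω ≤ s} = s := by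
      rw [measureReal_def, hunif s hs, ENNReal.toReal_ofReal hs.1.le]
    have hdisj : Disjoint (V ⁻¹' {q}) {ω | V ω ≤ r} :=
      Set.disjoint_left.mpr fun ω hω hω' => not_lt.mpr hω' (hrq.trans_eq (Eq.symm hω))
    rw [← hreal ⟨hr, hrq.trans hq.2⟩,
      ← measureReal_union hdisj (measurableSet_le hV measurable_const)]
    refine (measureReal_mono ?_).trans_eq (hreal hq)
    exact union_subset (fun ω hω => le_of_eq hω) fun ω hω => le_trans (α := ℝ) hω hrq.le
  -- `r` is within half the supposed atom of `q`, a contradiction; the maximum with `q / 2` keeps it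
  -- positive.
  have h := hle (lt_max_of_lt_right (half_pos hq.1))
    (max_lt (sub_lt_self q (half_pos hpos)) (half_lt_self hq.1))
  linarith [le_max_left (q - P.real (V ⁻¹' {q}) / 2) (q / 2)]

/-- The bootstrap is unconditionally valid if its conditional laws are asymptotically measurable for
the conditioning elements of the original statistic. -/
theorem unconditionallyValid_of_asymptoticallyMeasurableGiven {τn τstar : ∀ n, Ω n → ℝ}
    {X : ∀ n, Ω n → A n} {D : ∀ n, Ω n → B n} {τ : Ωl → ℝ} {Xl : Ωl → Al} {Yl : Ωl → Bl}
    (hτstar : ∀ n, Measurable (τstar n)) (hX : ∀ n, Measurable (X n))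
    (hD : ∀ n, Measurable (D n)) {T : ∀ n, B n → ℝ} (hT : ∀ n, Measurable (T n))
    (hτn : ∀ n ω, τn n ω = T n (D n ω)) (hτ : Measurable τ) (hXl : Measurable Xl)
    (hYl : Measurable Yl) (hconv : JointCondConv P Pl τn X τstar D τ Xl τ Yl)
    (hasymp : AsymptoticallyMeasurableGiven P τstar D X) (hYX : MeasurableGiven Yl Xl)
    (hc : ∀ᵐ ω ∂Pl, Continuous (randomCdf Pl τ Yl ω)) :
    UnconditionallyValid P τn τstar D := by
  have hτnm (n : ℕ) : Measurable (τn n) := by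
    rw [funext (hτn n)]
    exact (hT n).comp (hD n)
  have hlim := tendstoInDistribution_cdf_condLaw_apply hτnm hτstar hX hD hτ hτ hXl hYl hconv hasymp
    hYX hc
  have hunif {q : ℝ} (hq : q ∈ Ioo (0 : ℝ) 1) := measure_cdf_condLaw_le hτ hYl hc hq
  intro q hq
  have hnull : (Pl.map fun ω => cdf (condLaw Pl τ Yl ω) (τ ω)) (frontier (Iic q)) = 0 := by
    rw [frontier_Iic, Measure.map_apply_of_aemeasurable hlim.aemeasurable_limit
      (measurableSet_singleton q)]
    exact measure_preimage_singleton_eq_zero_of_uniform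
      ((measurable_cdf_kernel (condDistrib τ Yl Pl)).comp (hYl.prodMk hτ)) (fun _ => hunif) hq
  have hmeas := ProbabilityMeasure.tendsto_measure_of_null_frontier_of_tendsto' hlim.tendsto hnull
  simp only [ProbabilityMeasure.coe_mk] at hmeas
  rw [Measure.map_apply_of_aemeasurable hlim.aemeasurable_limit measurableSet_Iic] at hmeas
  change Tendsto _ _ (𝓝 (Pl {ω | cdf (condLaw Pl τ Yl ω) (τ ω) ≤ q})) at hmeas
  rw [hunif hq] at hmeas
  have hreal := (ENNReal.tendsto_toReal ENNReal.ofReal_ne_top).comp hmeas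
  rw [ENNReal.toReal_ofReal hq.1.le] at hreal
  refine hreal.congr fun n => ?_
  rw [Function.comp_apply, Measure.map_apply_of_aemeasurable (hlim.forall_aemeasurable n)
    measurableSet_Iic]
  refine congrArg ENNReal.toReal (measure_congr ?_)
  filter_upwards [bootstrapPValue_ae_eq (hτstar n) (hD n) (hT n) (hτn n)] with ω hω
  exact propext (by change _ ≤ q ↔ _ ≤ q; rw [hω])

/-- The case of asymptotically identical conditional laws. -/
theorem asymptoticallyMeasurableGiven_of_jointCondConv_self {τn τstar : ∀ n, Ω n → ℝ}
    {X : ∀ n, Ω n → A n} {D : ∀ n, Ω n → B n} {τ : Ωl → ℝ} {Xl : Ωl → Al}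
    (hτn : ∀ n, Measurable (τn n)) (hτstar : ∀ n, Measurable (τstar n))
    (hX : ∀ n, Measurable (X n)) (hD : ∀ n, Measurable (D n))
    (hconv : JointCondConv P Pl τn X τstar D τ Xl τ Xl) :
    AsymptoticallyMeasurableGiven P τstar D X := by
  intro k ε hε
  refine ⟨fun n => condExpGiven (P n) (fun ω => k (τn n ω)) (X n),
    fun n => measurableGiven_condExpGiven _ _ _, fun n => integrable_condExp, ?_⟩
  -- With the same test function on both sides the two limit coordinates coincide, so the mean
  -- distance vanishes. The cap `2‖k‖` only serves boundedness.
  have hlim := (weakConv_iff_tendstoInDistribution.mp (hconv k k)).tendsto_integral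
    (g := fun x => min |x.2 - x.1| (2 * ‖k‖)) (by fun_prop) (C := 2 * ‖k‖) (fun x => by
      rw [abs_of_nonneg (le_min (abs_nonneg _) (by positivity))]
      exact min_le_right _ _)
  have h0 : ∫ ω, min |condExpGiven Pl (fun ω => k (τ ω)) Xl ω
      - condExpGiven Pl (fun ω => k (τ ω)) Xl ω| (2 * ‖k‖) ∂Pl = 0 := by
    simp
  simp only at hlim
  rw [h0] at hlim
  filter_upwards [hlim.eventually (gt_mem_nhds hε)] with n hn
  refine le_trans (le_of_eq (integral_congr_ae ?_)) hn.le
  filter_upwards [ae_abs_condExpGiven_le (hτn n) (hX n) k,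
    ae_abs_condExpGiven_le (hτstar n) (hD n) k] with ω h1 h2
  refine (min_eq_left ?_).symm
  rw [two_mul]
  exact (abs_sub _ _).trans (add_le_add h2 h1)

/-- The case where the limiting conditioning element is approximated by `Xₙ`-measurable elements. -/
theorem asymptoticallyMeasurableGiven_of_jointCondConvWith {τn τstar : ∀ n, Ω n → ℝ}
    {X : ∀ n, Ω n → A n} {D : ∀ n, Ω n → B n} {τ τ' : Ωl → ℝ} {Xl : Ωl → Al}
    {S : Type*} [TopologicalSpace S] [PolishSpace S] [MeasurableSpace S] [BorelSpace S]
    {V : ∀ n, Ω n → S} {Vl : Ωl → S}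
    (hτstar : ∀ n, Measurable (τstar n)) (hτ' : Measurable τ')
    (hX : ∀ n, Measurable (X n)) (hD : ∀ n, Measurable (D n)) (hVl : Measurable Vl)
    (hV : ∀ n, MeasurableGiven (V n) (X n))
    (hconv : JointCondConvWith P Pl τn X τstar D V τ Xl τ' Vl Vl) :
    AsymptoticallyMeasurableGiven P τstar D X := by
  intro k ε hε
  let := TopologicalSpace.upgradeIsCompletelyMetrizable S
  have : IsProbabilityMeasure (Pl.map Vl) := Measure.isProbabilityMeasure_map hVl.aemeasurable
  have hkm : StronglyMeasurable fun p : S × ℝ => k p.2 :=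
    (k.continuous.measurable.comp measurable_snd).stronglyMeasurable
  have hφm : StronglyMeasurable fun x : S => ∫ t, k t ∂condDistrib τ' Vl Pl x :=
    hkm.integral_condDistrib (Y := τ') (X := Vl) (μ := Pl)
  have hφi : Integrable (fun x : S => ∫ t, k t ∂condDistrib τ' Vl Pl x) (Pl.map Vl) :=
    Integrable.of_bound hφm.aestronglyMeasurable ‖k‖ (Eventually.of_forall fun x =>
      (norm_integral_le_of_norm_le_const
        (Eventually.of_forall fun t => k.norm_coe_le_norm t)).trans_eq (by simp))
  -- The regression function of `k(τ')` on `Vl` is merely measurable, and weak convergence sees only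
  -- continuous functions; density of these in `L¹` of the law of `Vl` supplies `g`.
  obtain ⟨g, hg, -⟩ := hφi.exists_boundedContinuous_integral_sub_le (half_pos hε)
  have hφg : Measurable fun x : S => ‖∫ t, k t ∂condDistrib τ' Vl Pl x - g x‖ :=
    (hφm.measurable.sub g.continuous.measurable).norm
  rw [integral_map hVl.aemeasurable hφg.aestronglyMeasurable] at hg
  have hgV (n : ℕ) : MeasurableGiven (fun ω => g (V n ω)) (X n) :=
    g.continuous.measurable.comp (hV n)
  refine ⟨fun n ω => g (V n ω), hgV, fun n => Integrable.of_bound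
    ((hgV n).mono (hX n).comap_le le_rfl).aestronglyMeasurable ‖g‖
      (Eventually.of_forall fun ω => g.norm_coe_le_norm _), ?_⟩
  have hlim := (weakConv_iff_tendstoInDistribution.mp (hconv 0 k)).tendsto_integral
    (g := fun x => min |x.2.1 - g x.2.2| (‖k‖ + ‖g‖)) (by fun_prop) (C := ‖k‖ + ‖g‖) (fun x => by
      rw [abs_of_nonneg (le_min (abs_nonneg _) (by positivity))]
      exact min_le_right _ _)
  have h0 : ∫ ω, min |condExpGiven Pl (fun ω => k (τ' ω)) Vl ω - g (Vl ω)| (‖k‖ + ‖g‖) ∂Pl < ε := by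
    refine lt_of_le_of_lt ?_ (half_lt_self hε)
    refine le_trans (le_of_eq (integral_congr_ae ?_)) hg
    filter_upwards [condExpGiven_ae_eq_integral_condLaw hτ' hVl k,
      ae_abs_condExpGiven_le hτ' hVl k] with ω h1 h2
    rw [min_eq_left ((abs_sub _ _).trans (add_le_add h2 (g.norm_coe_le_norm _))), h1]
    rfl
  filter_upwards [hlim.eventually (gt_mem_nhds h0)] with n hn
  refine le_trans (le_of_eq (integral_congr_ae ?_)) hn.le
  filter_upwards [ae_abs_condExpGiven_le (hτstar n) (hD n) k] with ω h1
  exact (min_eq_left ((abs_sub _ _).trans (add_le_add h1 (g.norm_coe_le_norm _)))).symm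

end Validity

/-! ### The theorem. -/

theorem corollaryp2
    -- the probability spaces of the data and of the auxiliary bootstrap variates
    {Ω : ℕ → Type*} [∀ n, MeasurableSpace (Ω n)]
    (P : ∀ n, Measure (Ω n)) [∀ n, IsProbabilityMeasure (P n)]
    -- the Polish state spaces of the data, the auxiliary variates and the conditioning elements
    {SD SW SX : ℕ → Type*}
    [∀ n, TopologicalSpace (SD n)] [∀ n, PolishSpace (SD n)]
    [∀ n, MeasurableSpace (SD n)] [∀ n, BorelSpace (SD n)]
    [∀ n, TopologicalSpace (SW n)] [∀ n, PolishSpace (SW n)]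
    [∀ n, MeasurableSpace (SW n)] [∀ n, BorelSpace (SW n)]
    [∀ n, TopologicalSpace (SX n)] [∀ n, PolishSpace (SX n)]
    [∀ n, MeasurableSpace (SX n)] [∀ n, BorelSpace (SX n)]
    (D : ∀ n, Ω n → SD n) (hD : ∀ n, Measurable (D n))
    (W : ∀ n, Ω n → SW n) (hW : ∀ n, Measurable (W n))
    -- the original statistic is a function of the data, the bootstrap statistic is a function of
    -- the data and the auxiliary variates
    (T : ∀ n, SD n → ℝ) (hT : ∀ n, Measurable (T n))
    (Tstar : ∀ n, SD n × SW n → ℝ) (hTstar : ∀ n, Measurable (Tstar n))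
    (τn : ∀ n, Ω n → ℝ) (hτn : ∀ n ω, τn n ω = T n (D n ω))
    (τstar : ∀ n, Ω n → ℝ) (hτstar : ∀ n ω, τstar n ω = Tstar n (D n ω, W n ω))
    (Xn : ∀ n, Ω n → SX n) (hXn : ∀ n, MeasurableGiven (Xn n) (D n))
    -- the probability space of the limits
    {Ωl : Type*} [MeasurableSpace Ωl] (Pl : Measure Ωl) [IsProbabilityMeasure Pl]
    (τ : Ωl → ℝ) (hτ : Measurable τ)
    {S S' S'' : Type*}
    [TopologicalSpace S] [PolishSpace S] [MeasurableSpace S] [BorelSpace S]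
    [TopologicalSpace S'] [PolishSpace S'] [MeasurableSpace S'] [BorelSpace S']
    [TopologicalSpace S''] [PolishSpace S''] [MeasurableSpace S''] [BorelSpace S''] :
    -- joint weak convergence of the conditional cdf's
    (∀ (X : Ωl → S) (X' : Ωl → S'), Measurable X → Measurable X' →
      JointCondConv P Pl τn Xn τstar D τ X τ X' →
      (∀ᵐ ω ∂Pl, Continuous (randomCdf Pl τ X ω)) →
      (∀ᵐ ω ∂Pl, Continuous (randomCdf Pl τ X' ω)) →
      WeakConv P Pl
        (fun n ω => (randomCdf (P n) (τn n) (Xn n) ω, randomCdf (P n) (τstar n) (D n) ω))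
        (fun ω => (randomCdf Pl τ X ω, randomCdf Pl τ X' ω))) ∧
    -- unconditional validity when `X' = X`
    (∀ (X : Ωl → S), Measurable X →
      JointCondConv P Pl τn Xn τstar D τ X τ X →
      (∀ᵐ ω ∂Pl, Continuous (randomCdf Pl τ X ω)) →
      UnconditionallyValid P τn τstar D) ∧
    -- unconditional validity when `X = (X', X'')`
    (∀ (X : Ωl → S' × S'') (X' : Ωl → S') (X'' : Ωl → S''), Measurable X' → Measurable X'' →
      (∀ ω, X ω = (X' ω, X'' ω)) →
      JointCondConv P Pl τn Xn τstar D τ X τ X' →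
      (∀ᵐ ω ∂Pl, Continuous (randomCdf Pl τ X ω)) →
      (∀ᵐ ω ∂Pl, Continuous (randomCdf Pl τ X' ω)) →
      ∀ (Xn' : ∀ n, Ω n → S'), (∀ n, MeasurableGiven (Xn' n) (Xn n)) →
      JointCondConvWith P Pl τn Xn τstar D Xn' τ X τ X' X' →
      UnconditionallyValid P τn τstar D) := by
  have hXm (n : ℕ) : Measurable (Xn n) := (hXn n).mono (hD n).comap_le le_rfl
  have hτm (n : ℕ) : Measurable (τn n) := by
    rw [funext (hτn n)]
    exact (hT n).comp (hD n)
  have hτsm (n : ℕ) : Measurable (τstar n) := by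
    rw [funext (hτstar n)]
    exact (hTstar n).comp ((hD n).prodMk (hW n))
  refine ⟨fun X X' hX hX' hconv hc hc' =>
    weakConv_randomCdf hτm hτsm hXm hD hτ hτ hX hX' hconv hc hc', fun X hX hconv hc => ?_,
    fun X X' X'' hX' hX'' hXeq hconv _ hc' Xn' hXn' hconv' => ?_⟩
  · exact unconditionallyValid_of_asymptoticallyMeasurableGiven hτsm hXm hD hT hτn hτ hX hX hconv
      (asymptoticallyMeasurableGiven_of_jointCondConv_self hτm hτsm hXm hD hconv)
      (comap_measurable X) hc
  · obtain rfl : X = fun ω => (X' ω, X'' ω) := funext hXeq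
    exact unconditionallyValid_of_asymptoticallyMeasurableGiven hτsm hXm hD hT hτn hτ
      (hX'.prodMk hX'') hX' hconv
      (asymptoticallyMeasurableGiven_of_jointCondConvWith hτsm hτ hXm hD hX' hXn' hconv')
      (measurable_fst.comp (comap_measurable _)) hc'
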